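/- For every integer $n \ge 6$ there exists a convex polyhedron $C$ in hyperbolic space $\mathbb{H}^3$ (a convex set with nonempty interior that is the intersection of a family of closed half-spaces whose bounding planes are locally finite) such that: 1. $C$ has infinite hyperbolic volume; 2. $C$ has at least one (two-dimensional) face, and every face of $C$ is a regular $n$-gon with right interior angles contained in a totally geodesic hyperbolic plane (that is, a convex $n$-gon all of whose sides have equal length and all of whose interior angles are $\pi/2$); 3. whenever two distinct faces of $C$ intersect, their intersection is a common side of both faces, and the dihedral angle of $C$ along this side is $\pi/2$; 4. at each vertex of $C$ exactly three faces and exactly three edges of $C$ meet. -/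

import Mathlib

noncomputable section

namespace Hyp3

/-- The Lorentzian bilinear form of signature `(3,1)` on `ℝ⁴`. -/
def lor (x y : Fin 4 → ℝ) : ℝ :=
  -(x 0 * y 0) + x 1 * y 1 + x 2 * y 2 + x 3 * y 3

/-- Hyperbolic 3-space, in the hyperboloid model, with the topology induced from `ℝ⁴`
(which is also the topology of the hyperbolic distance). -/
abbrev H3 : Type := {x : Fin 4 → ℝ // lor x x = -1 ∧ 0 < x 0}

/-- The hyperbolic distance. -/
def hdist (x y : H3) : ℝ := Real.arcosh (-lor x.1 y.1)

/-- The geodesic segment joining two points of hyperbolic space. -/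
def segment (x y : H3) : Set H3 :=
  {z | ∃ a b : ℝ, 0 ≤ a ∧ 0 ≤ b ∧ z.1 = a • x.1 + b • y.1}

/-- Geodesic convexity. -/
def IsConvex (K : Set H3) : Prop := ∀ x ∈ K, ∀ y ∈ K, segment x y ⊆ K

/-- The geodesic convex hull. -/
def hull (s : Set H3) : Set H3 := ⋂₀ {K | IsConvex K ∧ s ⊆ K}

/-- The orthogonal projection of `x` to the tangent space `p^⊥` of hyperbolic space at `p`; for
`x ≠ p` it is a positive multiple of the initial velocity of the geodesic from `p` to `x`. -/
def toward (p x : H3) : Fin 4 → ℝ := x.1 + lor x.1 p.1 • p.1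

/-- The angle at `p` between the geodesic segments from `p` to `x` and from `p` to `y`
(for `x ≠ p`, `y ≠ p`), measured in the tangent space at `p`, on which `lor` is the
Riemannian inner product. -/
def angle (x p y : H3) : ℝ :=
  Real.arccos (lor (toward p x) (toward p y) /
    (√(lor (toward p x) (toward p x)) * √(lor (toward p y) (toward p y))))

/-- Unit spacelike vectors. They parametrize the half-spaces of hyperbolic space. -/
abbrev Normal : Type := {u : Fin 4 → ℝ // lor u u = 1}

/-- The totally geodesic hyperbolic plane orthogonal to `u`. -/
def plane (u : Normal) : Set H3 := {x | lor x.1 u.1 = 0}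

/-- The closed half-space bounded by `plane u` with outward unit normal `u`. -/
def halfSpace (u : Normal) : Set H3 := {x | lor x.1 u.1 ≤ 0}

/-- The interior dihedral angle of `halfSpace u ∩ halfSpace v` along the line
`plane u ∩ plane v` (when these planes cross): at every point of this line, `u` and `v` are tangent
vectors, namely the outward unit normals, and the dihedral angle is `π` minus their angle. -/
def dihedralAngle (u v : Normal) : ℝ := Real.pi - Real.arccos (lor u.1 v.1)

/-- A (three-dimensional) convex polyhedron: a convex set with nonempty interior that is the
intersection of a family of closed half-spaces whose bounding planes are locally finite. -/
structure IsConvexPolyhedron (C : Set H3) : Prop where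
  convex : IsConvex C
  interior_nonempty : (interior C).Nonempty
  halfSpaces : ∃ S : Set Normal,
    LocallyFinite (fun u : S => plane u.1) ∧ C = ⋂ u ∈ S, halfSpace u

/-- `F` is the part of `K` cut out by the plane with normal `u`, which supports `K`, and `F` has
dimension `k`. (A convex set has dimension `k` if the smallest totally geodesic subspace containing
it, which is the trace of its linear span, has dimension `k`.) -/
def IsFaceWithNormal (k : ℕ) (K F : Set H3) (u : Normal) : Prop :=
  K ⊆ halfSpace u ∧ F = K ∩ plane u ∧
    Module.finrank ℝ (Submodule.span ℝ ((fun x : H3 => x.1) '' F)) = k + 1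

/-- `F` is a `k`-dimensional face of the convex set `K`. For a polyhedron these are its vertices
(`k = 0`), edges (`k = 1`) and faces in the usual sense (`k = 2`); for a convex polygon
`k = 0` gives its vertices and `k = 1` its sides. -/
def IsFace (k : ℕ) (K F : Set H3) : Prop := ∃ u : Normal, IsFaceWithNormal k K F u

/-- `F` is a regular `n`-gon with right interior angles lying in a plane: it is the convex hull of
`n` distinct points of a plane, the segments joining cyclically consecutive points are sides
of `F`, all these sides have the same length, and all interior angles are `π / 2`. -/
def IsRegularRightAngledPolygon (n : ℕ) (F : Set H3) : Prop :=
  (∃ u : Normal, F ⊆ plane u) ∧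
  ∃ v : ZMod n → H3, Function.Injective v ∧ F = hull (Set.range v) ∧
    (∀ i, IsFace 1 F (segment (v i) (v (i + 1)))) ∧
    (∃ r : ℝ, ∀ i, hdist (v i) (v (i + 1)) = r) ∧
    ∀ i, angle (v (i - 1)) (v i) (v (i + 1)) = Real.pi / 2

theorem lift_mem (y : Fin 3 → ℝ) :
    lor ![√(1 + y 0 ^ 2 + y 1 ^ 2 + y 2 ^ 2), y 0, y 1, y 2]
        ![√(1 + y 0 ^ 2 + y 1 ^ 2 + y 2 ^ 2), y 0, y 1, y 2] = -1 ∧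
      0 < ![√(1 + y 0 ^ 2 + y 1 ^ 2 + y 2 ^ 2), y 0, y 1, y 2] 0 := by
  have h : 0 < 1 + y 0 ^ 2 + y 1 ^ 2 + y 2 ^ 2 := by positivity
  refine ⟨?_, by simpa using Real.sqrt_pos.2 h⟩
  simp only [lor, Matrix.cons_val]
  rw [Real.mul_self_sqrt h.le]
  ring

/-- The global parametrization of the hyperboloid as a graph over `ℝ³`. -/
def lift (y : Fin 3 → ℝ) : H3 :=
  ⟨![√(1 + y 0 ^ 2 + y 1 ^ 2 + y 2 ^ 2), y 0, y 1, y 2], lift_mem y⟩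

/-- The hyperbolic volume: in the graph parametrization of the hyperboloid the Riemannian volume
element is `dy₁ dy₂ dy₃ / √(1 + |y|²)`. -/
def hypVolume : MeasureTheory.Measure H3 :=
  ((MeasureTheory.volume : MeasureTheory.Measure (Fin 3 → ℝ)).withDensity
    (fun y => ENNReal.ofReal (1 / √(1 + y 0 ^ 2 + y 1 ^ 2 + y 2 ^ 2)))).map lift

end Hyp3

end

/-! The faces of `C` are the images of one right-angled regular `n`-gon under the reflection group
of the triangle with angles `π/n`, `π/2`, `π/3`. Its three mirrors (`mirror`) are the bisector of a
side, the bisector of an angle, and the plane exchanging the plane of the polygon with the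
orthogonal plane through a side; the right angle between these two planes is what produces the
`π/3`. With `A = normA n`, the group preserves the linear form `x 0 + A * x 3` (`tilingRep_zero`),
that is, it fixes the vector `(-1, 0, 0, A)`. For `n ≥ 6` one has `A ≥ 1`, so this vector is null
(`n = 6`) or spacelike (`n ≥ 7`): the polygons follow a tiling, three at each vertex, of a
horosphere or of a surface equidistant from a plane, instead of closing up around a point. `C` is
the intersection of the half-spaces whose outward normals form the orbit of `faceNormal`.

The heart is that two normals of this orbit are equal, orthogonal, or have product at most `-1`
(`orbit_cases`, `rightAngled`). By invariance one of them may be taken to be `faceNormal`, and the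
product is then the coordinate `x 3` of the other. One argues by induction on the length of the
group element. The first two reflections fix `x 3`. The third lowers it or leaves it unchanged
whenever it increases the length; this sign comes from the positivity of roots in a Coxeter group
(`map_root_nonpos_of_not_isRightDescent`). So a value at most `-1` persists, and only the neighbours
of the base polygon have to be computed.

The rest holds for any such right-angled family. It is locally finite, planes that meet are
orthogonal, and the normals active at a point of a face detect every direction orthogonal to that
face (`exists_normal_not_orthogonal`). Hence faces come from members of the family, edges from pairs
and vertices from triples. Planes with product at most `-1` do not cut the base face, which is
therefore the polygon (`cell_inter_plane`); the group carries this to all faces. Finally `C`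
contains the part of a horoball on one side of a plane (`mem_cell_of_horoball`), and boxes in it
have arbitrarily large volume. -/

namespace CoxeterSystem

/-! ### Positivity of roots in a Coxeter group -/

variable {B W : Type*} [Group W] {M : CoxeterMatrix B} (cs : CoxeterSystem M W)

/-- Every element factors, with additive lengths, as an element without right descents in `{i, j}`
times an alternating word in `i` and `j`. -/
theorem exists_eq_mul_alternatingWord (i j : B) (w : W) :
    ∃ v : W, ∃ m : ℕ, ¬ cs.IsRightDescent v i ∧ ¬ cs.IsRightDescent v j ∧
      cs.length w = cs.length v + m ∧
      (w = v * cs.wordProd (alternatingWord i j m) ∨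
        w = v * cs.wordProd (alternatingWord j i m)) := by
  induction hk : cs.length w using Nat.strong_induction_on generalizing w with
  | _ k ih =>
    subst hk
    have key : ∀ i j : B, cs.IsRightDescent w i →
        (∃ v : W, ∃ m : ℕ, ¬ cs.IsRightDescent v i ∧ ¬ cs.IsRightDescent v j ∧
          cs.length (w * cs.simple i) = cs.length v + m ∧
          (w * cs.simple i = v * cs.wordProd (alternatingWord i j m) ∨
            w * cs.simple i = v * cs.wordProd (alternatingWord j i m))) →
        ∃ v : W, ∃ m : ℕ, ¬ cs.IsRightDescent v i ∧ ¬ cs.IsRightDescent v j ∧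
          cs.length w = cs.length v + m ∧ w = v * cs.wordProd (alternatingWord j i m) := by
      rintro i j hd ⟨v, m, hvi, hvj, hl, h⟩
      have hd' := cs.isRightDescent_iff.1 hd
      have hcons : ∀ x : W, w * cs.simple i = x → w = x * cs.simple i := by
        rintro x rfl; simp
      rcases h with h | h
      · refine ⟨v, m + 1, hvi, hvj, by omega, ?_⟩
        rw [alternatingWord_succ, wordProd_concat, ← mul_assoc]
        exact hcons _ h
      · cases m with
        | zero =>
          refine ⟨v, 1, hvi, hvj, by omega, ?_⟩
          have := hcons _ h
          simpa [alternatingWord] using this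
        | succ m =>
          -- Cancelling the common last letter would write `w` with at most `length v + m` letters,
          -- fewer than `w * cs.simple i` needs, although `i` is a descent of `w`.
          exfalso
          rw [alternatingWord_succ, wordProd_concat, ← mul_assoc] at h
          have h' : w = v * cs.wordProd (alternatingWord i j m) := mul_right_cancel h
          have h1 := cs.length_mul_le v (cs.wordProd (alternatingWord i j m))
          have h2 := cs.length_wordProd_le (alternatingWord i j m)
          rw [length_alternatingWord] at h2
          rw [← h'] at h1
          omega
    by_cases hi : cs.IsRightDescent w i
    · obtain ⟨v, m, h1, h2, h3, h4⟩ := key i j hi (ih _ hi _ rfl)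
      exact ⟨v, m, h1, h2, h3, Or.inr h4⟩
    · by_cases hj : cs.IsRightDescent w j
      · obtain ⟨v, m, h1, h2, h3, h4⟩ := ih _ hj _ rfl
        obtain ⟨v, m, h1, h2, h3, h4⟩ := key j i hj ⟨v, m, h2, h1, h3, h4.symm⟩
        exact ⟨v, m, h2, h1, h3, Or.inl h4⟩
      · exact ⟨w, 0, hi, hj, rfl, Or.inl (by simp [alternatingWord])⟩

variable {V : Type*} [AddCommGroup V] [Module ℝ V] (ρ : W →* Module.End ℝ V) (a : B → V)

/-- The action of an alternating word on a simple root, in terms of sines. -/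
theorem alternatingWord_smul_root
    (hself : ∀ i, ρ (cs.simple i) (a i) = -a i)
    (hne : ∀ i j, i ≠ j →
      ρ (cs.simple i) (a j) = a j + (2 * Real.cos (Real.pi / M i j)) • a i)
    {i j : B} (hij : i ≠ j) (m : ℕ) :
    Real.sin (Real.pi / M i j) • ρ (cs.wordProd (alternatingWord i j m)) (a i) =
      if Even m then
        Real.sin ((m + 1) * (Real.pi / M i j)) • a i + Real.sin (m * (Real.pi / M i j)) • a j
      else
        Real.sin ((m + 1) * (Real.pi / M i j)) • a j + Real.sin (m * (Real.pi / M i j)) • a i := by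
  set θ := Real.pi / M i j with hθ
  have hji : Real.pi / M j i = θ := by rw [M.symmetric j i]
  have hsin : ∀ m : ℕ, 2 * Real.cos θ * Real.sin ((m + 1) * θ) - Real.sin (m * θ) =
      Real.sin ((((m + 1 : ℕ) : ℝ) + 1) * θ) := by
    intro m
    have h1 : (m : ℝ) * θ = (m + 1) * θ - θ := by ring
    have h2 : (((m + 1 : ℕ) : ℝ) + 1) * θ = (m + 1) * θ + θ := by push_cast; ring
    rw [h1, h2, Real.sin_sub, Real.sin_add]; ring
  induction m with
  | zero => simp [alternatingWord]
  | succ m ih =>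
    rw [alternatingWord_succ', wordProd_cons, map_mul, Module.End.mul_apply, ← map_smul, ih]
    by_cases hm : Even m
    · have hm' : ¬ Even (m + 1) := by simpa [Nat.even_add_one] using hm
      rw [if_pos hm, if_pos hm, if_neg hm', map_add, map_smul, map_smul, hself, hne j i hij.symm,
        hji, ← hsin]
      push_cast
      module
    · have hm' : Even (m + 1) := by simpa [Nat.even_add_one] using hm
      rw [if_neg hm, if_neg hm, if_pos hm', map_add, map_smul, map_smul, hself, hne i j hij,
        ← hθ, ← hsin]
      push_cast
      module

/-- A linear form that is nonpositive on the simple roots is nonpositive on `w • a i` whenever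
`i` is not a right descent of `w`. -/
theorem map_root_nonpos_of_not_isRightDescent
    (hM : ∀ i j, M i j ≠ 0)
    (hself : ∀ i, ρ (cs.simple i) (a i) = -a i)
    (hne : ∀ i j, i ≠ j →
      ρ (cs.simple i) (a j) = a j + (2 * Real.cos (Real.pi / M i j)) • a i)
    (f : V →ₗ[ℝ] ℝ) (hf : ∀ i, f (a i) ≤ 0) (w : W) (i : B) (hw : ¬ cs.IsRightDescent w i) :
    f (ρ w (a i)) ≤ 0 := by
  induction hk : cs.length w using Nat.strong_induction_on generalizing w i with
  | _ k ih =>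
    subst hk
    by_cases h1 : w = 1
    · simpa [h1] using hf i
    obtain ⟨j, hj⟩ := cs.exists_rightDescent_of_ne_one h1
    have hij : i ≠ j := by rintro rfl; exact hw hj
    obtain ⟨v, m, hvi, hvj, hl, h⟩ := cs.exists_eq_mul_alternatingWord i j w
    have hm0 : m ≠ 0 := by
      rintro rfl
      have : w = v := by rcases h with h | h <;> simpa [alternatingWord] using h
      exact hvj (this ▸ hj)
    obtain ⟨m, rfl⟩ := Nat.exists_eq_succ_of_ne_zero hm0
    -- the alternating word cannot end in `i`
    have hend : w ≠ v * cs.wordProd (alternatingWord j i (m + 1)) := by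
      intro h
      apply hw
      have hws : w * cs.simple i = v * cs.wordProd (alternatingWord i j m) := by
        rw [h, alternatingWord_succ, wordProd_concat, ← mul_assoc, simple_mul_simple_cancel_right]
      have h1 := cs.length_mul_le v (cs.wordProd (alternatingWord i j m))
      have h2 := cs.length_wordProd_le (alternatingWord i j m)
      rw [length_alternatingWord] at h2
      rw [IsRightDescent, hws]
      omega
    have h := h.resolve_right hend
    have hred : cs.IsReduced (alternatingWord i j (m + 1)) := by
      have h1 := cs.length_mul_le v (cs.wordProd (alternatingWord i j (m + 1)))
      have h2 := cs.length_wordProd_le (alternatingWord i j (m + 1))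
      rw [IsReduced]
      rw [← h] at h1
      rw [length_alternatingWord] at *
      omega
    have hlt : m + 1 < M i j := by
      rcases lt_trichotomy (m + 1) (M i j) with hlt | heq | hgt
      · exact hlt
      -- At full length `M i j` the braid relation turns the word into the one ending in `i`,
      -- already excluded.
      · exfalso
        apply hend
        have := cs.wordProd_braidWord_eq i j
        rw [braidWord, braidWord, M.symmetric j i, ← heq] at this
        rw [← this]
        exact h
      · exact absurd hred (cs.not_isReduced_alternatingWord i j (hM i j) hgt)
    have hfi := ih _ (by omega) v i hvi rfl
    have hfj := ih _ (by omega) v j hvj rfl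
    have hpos : (0 : ℝ) < M i j := by exact_mod_cast Nat.pos_of_ne_zero (hM i j)
    have hsin : ∀ k : ℕ, k ≤ M i j → 0 ≤ Real.sin (k * (Real.pi / M i j)) := by
      intro k hk
      apply Real.sin_nonneg_of_nonneg_of_le_pi (by positivity)
      rw [mul_div_assoc', div_le_iff₀ hpos, mul_comm]
      gcongr
    have hs : 0 < Real.sin (Real.pi / M i j) := by
      apply Real.sin_pos_of_pos_of_lt_pi (by positivity)
      rw [div_lt_iff₀ hpos]
      have : (2 : ℝ) ≤ M i j := by exact_mod_cast (by omega : 2 ≤ M i j)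
      nlinarith [Real.pi_pos]
    -- The alternating word sends `a i` to a combination of `a i` and `a j`. Since `m + 2 ≤ M i j`,
    -- the sines in it have arguments in `[0, π]`, so the induction hypotheses for the shorter `v`
    -- can be added up.
    have hkey : Real.sin (Real.pi / M i j) * f (ρ w (a i)) ≤ 0 := by
      have e : Real.sin (Real.pi / M i j) * f (ρ w (a i)) =
          f (ρ v (Real.sin (Real.pi / M i j) •
            ρ (cs.wordProd (alternatingWord i j (m + 1))) (a i))) := by
        rw [h, map_mul, Module.End.mul_apply, map_smul, map_smul, smul_eq_mul]
      have s1 := hsin (m + 1) hlt.le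
      have s2 := hsin (m + 2) hlt
      have e2 : (((m + 1 : ℕ) : ℝ) + 1) = ((m + 2 : ℕ) : ℝ) := by push_cast; ring
      rw [e, cs.alternatingWord_smul_root ρ a hself hne hij, e2]
      split_ifs <;> simp only [map_add, map_smul, smul_eq_mul] <;>
        exact add_nonpos (mul_nonpos_of_nonneg_of_nonpos s2 ‹_›)
          (mul_nonpos_of_nonneg_of_nonpos s1 ‹_›)
    exact nonpos_of_mul_nonpos_right hkey hs

end CoxeterSystem

noncomputable section

namespace Hyp3

/-! ### The Lorentzian form -/

/-- `lor` as a bilinear form. -/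
def lorForm : LinearMap.BilinForm ℝ (Fin 4 → ℝ) :=
  LinearMap.mk₂ ℝ lor (by intros; simp [lor]; ring) (by intros; simp [lor]; ring)
    (by intros; simp [lor]; ring) (by intros; simp [lor]; ring)

theorem lorForm_apply (x y : Fin 4 → ℝ) : lorForm x y = lor x y := rfl

theorem lor_comm (x y : Fin 4 → ℝ) : lor x y = lor y x := by simp only [lor]; ring

@[simp] theorem lor_add_left (x y z : Fin 4 → ℝ) : lor (x + y) z = lor x z + lor y z :=
  LinearMap.map_add₂ lorForm x y z

@[simp] theorem lor_add_right (x y z : Fin 4 → ℝ) : lor x (y + z) = lor x y + lor x z :=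
  map_add (lorForm x) y z

@[simp] theorem lor_sub_left (x y z : Fin 4 → ℝ) : lor (x - y) z = lor x z - lor y z :=
  LinearMap.map_sub₂ lorForm x y z

@[simp] theorem lor_sub_right (x y z : Fin 4 → ℝ) : lor x (y - z) = lor x y - lor x z :=
  map_sub (lorForm x) y z

@[simp] theorem lor_smul_left (r : ℝ) (x y : Fin 4 → ℝ) : lor (r • x) y = r * lor x y :=
  LinearMap.map_smul₂ lorForm r x y

@[simp] theorem lor_smul_right (r : ℝ) (x y : Fin 4 → ℝ) : lor x (r • y) = r * lor x y :=
  map_smul (lorForm x) r y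

@[simp] theorem lor_neg_left (x y : Fin 4 → ℝ) : lor (-x) y = -lor x y :=
  LinearMap.map_neg₂ lorForm x y

@[simp] theorem lor_neg_right (x y : Fin 4 → ℝ) : lor x (-y) = -lor x y :=
  map_neg (lorForm x) y

@[simp] theorem lor_zero_left (x : Fin 4 → ℝ) : lor 0 x = 0 := LinearMap.map_zero₂ lorForm x

@[simp] theorem lor_zero_right (x : Fin 4 → ℝ) : lor x 0 = 0 := map_zero (lorForm x)

theorem lor_sum_left {ι : Type*} (s : Finset ι) (f : ι → Fin 4 → ℝ) (y : Fin 4 → ℝ) :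
    lor (∑ i ∈ s, f i) y = ∑ i ∈ s, lor (f i) y :=
  LinearMap.map_sum₂ lorForm s f y

theorem eq_zero_of_forall_lor_eq_zero {x : Fin 4 → ℝ} (h : ∀ y, lor x y = 0) : x = 0 := by
  have h0 := h ![1, 0, 0, 0]
  have h1 := h ![0, 1, 0, 0]
  have h2 := h ![0, 0, 1, 0]
  have h3 := h ![0, 0, 0, 1]
  simp [lor] at h0 h1 h2 h3
  ext i; fin_cases i <;> simp [*]

theorem lorForm_nondegenerate : lorForm.Nondegenerate := by
  refine ⟨fun x h => eq_zero_of_forall_lor_eq_zero h, fun x h => ?_⟩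
  exact eq_zero_of_forall_lor_eq_zero fun y => (lor_comm x y).trans (h y)

theorem finrank_orthogonal (S : Submodule ℝ (Fin 4 → ℝ)) :
    Module.finrank ℝ (lorForm.orthogonal S) = 4 - Module.finrank ℝ S := by
  have := LinearMap.BilinForm.finrank_orthogonal lorForm_nondegenerate S
  simpa using this

theorem mem_orthogonal_span {s : Set (Fin 4 → ℝ)} {t : Fin 4 → ℝ} :
    t ∈ lorForm.orthogonal (Submodule.span ℝ s) ↔ ∀ x ∈ s, lor t x = 0 := by
  rw [LinearMap.BilinForm.mem_orthogonal_iff]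
  constructor
  · intro h x hx
    rw [lor_comm]
    exact h x (Submodule.subset_span hx)
  · intro h x hx
    have : Submodule.span ℝ s ≤ LinearMap.ker (lorForm t) :=
      Submodule.span_le.2 fun y hy => h y hy
    exact (lor_comm x t).trans (this hx)

theorem exists_ne_zero_orthogonal (S : Submodule ℝ (Fin 4 → ℝ)) (hS : Module.finrank ℝ S < 4) :
    ∃ t : Fin 4 → ℝ, t ≠ 0 ∧ ∀ x ∈ S, lor t x = 0 := by
  have h : 0 < Module.finrank ℝ (lorForm.orthogonal S) := by
    rw [finrank_orthogonal]; omega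
  have := Module.finrank_pos_iff.1 h
  obtain ⟨⟨t, ht⟩, h0⟩ := exists_ne (0 : lorForm.orthogonal S)
  refine ⟨t, by simpa using h0, fun x hx => ?_⟩
  rw [lor_comm]
  exact LinearMap.BilinForm.mem_orthogonal_iff.1 ht x hx

theorem cauchy_schwarz₃ (a b c d e f : ℝ) :
    (a * d + b * e + c * f) ^ 2 ≤ (a ^ 2 + b ^ 2 + c ^ 2) * (d ^ 2 + e ^ 2 + f ^ 2) := by
  nlinarith [sq_nonneg (a * e - b * d), sq_nonneg (a * f - c * d), sq_nonneg (b * f - c * e)]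

theorem H3.sq_zero (x : H3) : x.1 0 ^ 2 = 1 + (x.1 1 ^ 2 + x.1 2 ^ 2 + x.1 3 ^ 2) := by
  have := x.2.1
  simp only [lor] at this
  linarith

theorem Normal.sq_zero (u : Normal) : u.1 1 ^ 2 + u.1 2 ^ 2 + u.1 3 ^ 2 = 1 + u.1 0 ^ 2 := by
  have := u.2
  simp only [lor] at this
  linarith

/-- The tangent space of hyperbolic space at a point is spacelike. -/
theorem lor_pos_of_orthogonal (x : H3) {t : Fin 4 → ℝ} (h : lor t x.1 = 0) (ht : t ≠ 0) :
    0 < lor t t := by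
  by_contra! hle
  have h1 := x.sq_zero
  have h2 := cauchy_schwarz₃ (t 1) (t 2) (t 3) (x.1 1) (x.1 2) (x.1 3)
  simp only [lor] at h hle
  have h3 : t 1 * x.1 1 + t 2 * x.1 2 + t 3 * x.1 3 = t 0 * x.1 0 := by linarith
  rw [h3, mul_pow, h1] at h2
  have hX : 0 ≤ x.1 1 ^ 2 + x.1 2 ^ 2 + x.1 3 ^ 2 := by positivity
  have hT : t 1 ^ 2 + t 2 ^ 2 + t 3 ^ 2 ≤ t 0 ^ 2 := by nlinarith
  have h4 : t 0 ^ 2 ≤ 0 := by nlinarith [mul_le_mul_of_nonneg_right hT hX]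
  apply ht
  ext i
  fin_cases i <;> simp only [Pi.zero_apply] <;> apply pow_eq_zero_iff (two_ne_zero) |>.1 <;>
    apply le_antisymm <;> first | positivity | skip
  · exact h4
  all_goals
    simp only [Fin.mk_one, Fin.reduceFinMk]
    nlinarith [sq_nonneg (t 1), sq_nonneg (t 2), sq_nonneg (t 3)]

/-- Two future timelike vectors have negative product. -/
theorem lor_neg_of_timelike {x y : Fin 4 → ℝ} (hx : lor x x < 0) (hx0 : 0 < x 0)
    (hy : lor y y < 0) (hy0 : 0 < y 0) : lor x y < 0 := by
  have h := cauchy_schwarz₃ (x 1) (x 2) (x 3) (y 1) (y 2) (y 3)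
  simp only [lor] at *
  have hlt : (x 1 ^ 2 + x 2 ^ 2 + x 3 ^ 2) * (y 1 ^ 2 + y 2 ^ 2 + y 3 ^ 2) <
      x 0 ^ 2 * y 0 ^ 2 :=
    mul_lt_mul'' (by linarith) (by linarith) (by positivity) (by positivity)
  have := abs_lt_of_sq_lt_sq (lt_of_le_of_lt h (by rwa [← mul_pow] at hlt)) (by positivity)
  linarith [(abs_lt.1 this).2]

theorem H3.lor_neg (x y : H3) : lor x.1 y.1 < 0 :=
  lor_neg_of_timelike (by simp [x.2.1]) x.2.2 (by simp [y.2.1]) y.2.2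

theorem pos_zero_of_lor_neg (x : H3) {y : Fin 4 → ℝ} (hy : lor y y < 0) (h : lor y x.1 < 0) :
    0 < y 0 := by
  by_contra! hle
  rcases hle.lt_or_eq with hlt | h0
  · have := lor_neg_of_timelike (x := -y) (by simpa) (by simpa) (by simp [x.2.1]) x.2.2
    simp at this
    linarith
  · simp only [lor, h0] at hy
    nlinarith [sq_nonneg (y 1), sq_nonneg (y 2), sq_nonneg (y 3)]

theorem H3.eq_of_smul {x y : H3} {r : ℝ} (h : x.1 = r • y.1) : x = y := by
  have hx := x.2.1
  have hx0 := x.2.2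
  have hy0 := y.2.2
  rw [h] at hx hx0
  simp [y.2.1] at hx
  simp at hx0
  have hr : 0 < r := by
    by_contra! hle
    nlinarith
  have : r = 1 := by nlinarith
  ext1
  rw [h, this, one_smul]

theorem linearIndependent_pair {x y : H3} (h : x ≠ y) : LinearIndependent ℝ ![x.1, y.1] := by
  rw [LinearIndependent.pair_iff' (by intro h0; have := x.2.2; simp [h0] at this)]
  intro r hr
  exact h (H3.eq_of_smul hr.symm).symm

/-! ### Convexity -/

/-- The point of hyperbolic space on the ray through a future timelike vector. -/
def ofTimelike (y : Fin 4 → ℝ) (hy : lor y y < 0) (hy0 : 0 < y 0) : H3 :=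
  ⟨(√(-lor y y))⁻¹ • y, by
    have hs : 0 < √(-lor y y) := Real.sqrt_pos.2 (by linarith)
    have h2 : √(-lor y y) ^ 2 = -lor y y := Real.sq_sqrt (by linarith)
    refine ⟨?_, by simpa using mul_pos (inv_pos.2 hs) hy0⟩
    rw [lor_smul_left, lor_smul_right]
    field_simp
    linarith⟩

/-- The cone over a set of points of hyperbolic space. -/
def cone (K : Set H3) : Set (Fin 4 → ℝ) := {y | ∃ r : ℝ, 0 < r ∧ ∃ x ∈ K, y = r • x.1}

/-- Geodesic segments are radial projections of linear ones, so geodesic convexity becomes closure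
of the cone under addition. Convexity arguments can then be done linearly, without normalizing. -/
theorem IsConvex.add_mem_cone {K : Set H3} (hK : IsConvex K) {y z : Fin 4 → ℝ}
    (hy : y ∈ cone K) (hz : z ∈ cone K) : y + z ∈ cone K := by
  obtain ⟨a, ha, x, hx, rfl⟩ := hy
  obtain ⟨b, hb, x', hx', rfl⟩ := hz
  have hneg := x.lor_neg x'
  have ht : lor (a • x.1 + b • x'.1) (a • x.1 + b • x'.1) < 0 := by
    simp [x.2.1, x'.2.1, lor_comm x'.1 x.1]
    nlinarith [mul_pos ha hb, mul_pos ha ha, mul_pos hb hb]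
  have h0 : 0 < (a • x.1 + b • x'.1) 0 := by
    simpa using add_pos (mul_pos ha x.2.2) (mul_pos hb x'.2.2)
  have hs : 0 < √(-lor (a • x.1 + b • x'.1) (a • x.1 + b • x'.1)) :=
    Real.sqrt_pos.2 (by linarith)
  refine ⟨√(-lor (a • x.1 + b • x'.1) (a • x.1 + b • x'.1)), hs, ofTimelike _ ht h0,
    hK x hx x' hx' ?_, ?_⟩
  · refine ⟨(√(-lor (a • x.1 + b • x'.1) (a • x.1 + b • x'.1)))⁻¹ * a,
      (√(-lor (a • x.1 + b • x'.1) (a • x.1 + b • x'.1)))⁻¹ * b, by positivity, by positivity, ?_⟩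
    simp only [ofTimelike]
    module
  · simp only [ofTimelike]
    rw [smul_smul, mul_inv_cancel₀ hs.ne', one_smul]

theorem smul_mem_cone {K : Set H3} {y : Fin 4 → ℝ} (hy : y ∈ cone K) {r : ℝ} (hr : 0 < r) :
    r • y ∈ cone K := by
  obtain ⟨a, ha, x, hx, rfl⟩ := hy
  exact ⟨r * a, by positivity, x, hx, by rw [smul_smul]⟩

theorem mem_cone_of_mem {K : Set H3} {x : H3} (hx : x ∈ K) : x.1 ∈ cone K :=
  ⟨1, one_pos, x, hx, (one_smul _ _).symm⟩

theorem mem_of_mem_cone {K : Set H3} {x : H3} (hx : x.1 ∈ cone K) : x ∈ K := by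
  obtain ⟨r, -, y, hy, h⟩ := hx
  rwa [H3.eq_of_smul h]

theorem IsConvex.sum_mem_cone {K : Set H3} (hK : IsConvex K) {ι : Type*} {s : Finset ι}
    (hs : s.Nonempty) {f : ι → Fin 4 → ℝ} (hf : ∀ i ∈ s, f i ∈ cone K) :
    ∑ i ∈ s, f i ∈ cone K :=
  Finset.sum_induction_nonempty f (· ∈ cone K) (fun _ _ => hK.add_mem_cone) hs hf

theorem isConvex_halfSpace (u : Normal) : IsConvex (halfSpace u) := by
  rintro x hx y hy z ⟨a, b, ha, hb, hz⟩
  simp only [halfSpace, Set.mem_ofPred_eq] at *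
  rw [hz]
  simp only [lor_add_left, lor_smul_left]
  nlinarith

theorem isConvex_plane (u : Normal) : IsConvex (plane u) := by
  rintro x hx y hy z ⟨a, b, ha, hb, hz⟩
  simp only [plane, Set.mem_ofPred_eq] at *
  rw [hz]
  simp [hx, hy]

theorem IsConvex.inter {K L : Set H3} (hK : IsConvex K) (hL : IsConvex L) : IsConvex (K ∩ L) :=
  fun x hx y hy _ hz => ⟨hK x hx.1 y hy.1 hz, hL x hx.2 y hy.2 hz⟩

theorem left_mem_segment (x y : H3) : x ∈ segment x y :=
  ⟨1, 0, zero_le_one, le_rfl, by simp⟩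

theorem right_mem_segment (x y : H3) : y ∈ segment x y :=
  ⟨0, 1, le_rfl, zero_le_one, by simp⟩

theorem finrank_span_segment {x y : H3} (h : x ≠ y) :
    Module.finrank ℝ (Submodule.span ℝ ((fun x : H3 => x.1) '' segment x y)) = 2 := by
  have e : Submodule.span ℝ ((fun x : H3 => x.1) '' segment x y) =
      Submodule.span ℝ (Set.range ![x.1, y.1]) := by
    apply le_antisymm
    · rw [Submodule.span_le]
      rintro _ ⟨z, ⟨a, b, -, -, hz⟩, rfl⟩
      simp only [hz]
      exact add_mem (Submodule.smul_mem _ _ (Submodule.subset_span ⟨0, rfl⟩))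
        (Submodule.smul_mem _ _ (Submodule.subset_span ⟨1, rfl⟩))
    · rw [Submodule.span_le]
      rintro _ ⟨i, rfl⟩
      fin_cases i
      · exact Submodule.subset_span ⟨x, left_mem_segment x y, rfl⟩
      · exact Submodule.subset_span ⟨y, right_mem_segment x y, rfl⟩
  rw [e, finrank_span_eq_card (linearIndependent_pair h), Fintype.card_fin]

/-- A convex set has a point that lies on a supporting plane only if the whole set does. -/
theorem IsConvex.exists_relint {K : Set H3} (hK : IsConvex K) (hne : K.Nonempty) :
    ∃ x ∈ K, ∀ u : Normal, K ⊆ halfSpace u → x ∈ plane u → K ⊆ plane u := by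
  obtain ⟨f, hf, hspan, -⟩ := Submodule.exists_fun_fin_finrank_span_eq ℝ
    ((fun x : H3 => x.1) '' K)
  choose g hgK hg using hf
  have hpos : 0 < Module.finrank ℝ (Submodule.span ℝ ((fun x : H3 => x.1) '' K)) := by
    rw [Module.finrank_pos_iff]
    obtain ⟨x, hx⟩ := hne
    refine ⟨⟨⟨x.1, Submodule.subset_span ⟨x, hx, rfl⟩⟩, 0, ?_⟩⟩
    intro h
    have h' : x.1 = 0 := congrArg Subtype.val h
    have := x.2.2
    simp [h'] at this
  have : NeZero (Module.finrank ℝ (Submodule.span ℝ ((fun x : H3 => x.1) '' K))) :=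
    ⟨hpos.ne'⟩
  -- The point is the normalized sum of a basis of the span chosen inside `K`. A supporting form is
  -- nonpositive on each summand, so if it vanishes at the sum it vanishes on the basis.
  obtain ⟨r, hr, x, hx, hsum⟩ := hK.sum_mem_cone (s := Finset.univ) Finset.univ_nonempty
    (f := fun i => (g i).1) fun i _ => mem_cone_of_mem (hgK i)
  refine ⟨x, hx, fun u hu hxu => ?_⟩
  have h0 : ∑ i, lor (g i).1 u.1 = 0 := by
    rw [← lor_sum_left, hsum, lor_smul_left, show lor x.1 u.1 = 0 from hxu, mul_zero]
  have h1 : ∀ i ∈ Finset.univ, lor (g i).1 u.1 = 0 :=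
    (Finset.sum_eq_zero_iff_of_nonpos fun i _ => hu (hgK i)).1 h0
  intro y hy
  have hy' : y.1 ∈ Submodule.span ℝ (Set.range f) := by
    rw [hspan]; exact Submodule.subset_span ⟨y, hy, rfl⟩
  have hker : Submodule.span ℝ (Set.range f) ≤ LinearMap.ker (lorForm u.1) := by
    rw [Submodule.span_le]
    rintro _ ⟨i, rfl⟩
    rw [← hg i]
    exact (lor_comm _ _).trans (h1 i (Finset.mem_univ i))
  exact (lor_comm _ _).trans (hker hy')

/-! ### Isometries -/

/-- An isometry of hyperbolic space, as a linear map of the ambient space together with its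
inverse. -/
structure Isom where
  /-- the underlying linear equivalence -/
  lin : (Fin 4 → ℝ) ≃ₗ[ℝ] (Fin 4 → ℝ)
  map_lor : ∀ x y, lor (lin x) (lin y) = lor x y
  map_pos : ∀ x : H3, 0 < lin x.1 0

namespace Isom

variable (g : Isom)

/-- The action on points. -/
def pt (x : H3) : H3 := ⟨g.lin x.1, (g.map_lor _ _).trans x.2.1, g.map_pos x⟩

/-- The action on normals. -/
def nrm (u : Normal) : Normal := ⟨g.lin u.1, (g.map_lor _ _).trans u.2⟩

/-- The inverse isometry. -/
def symm : Isom where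
  lin := g.lin.symm
  map_lor x y := by
    rw [← g.map_lor, LinearEquiv.apply_symm_apply, LinearEquiv.apply_symm_apply]
  map_pos x := by
    have hl : ∀ y : H3, lor (g.lin.symm x.1) y.1 = lor x.1 (g.pt y).1 := by
      intro y
      rw [← g.map_lor, LinearEquiv.apply_symm_apply]
      rfl
    -- The preimage of `x` is future-pointing because its product with `x` equals that of `x` with
    -- its image.
    apply pos_zero_of_lor_neg x
    · rw [← g.map_lor, LinearEquiv.apply_symm_apply, x.2.1]
      norm_num
    · rw [hl]
      exact H3.lor_neg _ _

@[simp] theorem symm_pt_pt (x : H3) : g.symm.pt (g.pt x) = x :=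
  Subtype.ext (g.lin.symm_apply_apply x.1)

@[simp] theorem pt_symm_pt (x : H3) : g.pt (g.symm.pt x) = x :=
  Subtype.ext (g.lin.apply_symm_apply x.1)

theorem pt_injective : Function.Injective g.pt := Function.LeftInverse.injective g.symm_pt_pt

theorem mem_image_pt {s : Set H3} {x : H3} : x ∈ g.pt '' s ↔ g.symm.pt x ∈ s := by
  constructor
  · rintro ⟨y, hy, rfl⟩
    simpa
  · intro h
    exact ⟨_, h, by simp⟩

theorem lor_pt_nrm (x : H3) (u : Normal) : lor (g.pt x).1 (g.nrm u).1 = lor x.1 u.1 :=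
  g.map_lor _ _

theorem pt_mem_plane {x : H3} {u : Normal} : g.pt x ∈ plane (g.nrm u) ↔ x ∈ plane u := by
  simp only [plane, Set.mem_ofPred_eq, lor_pt_nrm]

theorem pt_mem_halfSpace {x : H3} {u : Normal} :
    g.pt x ∈ halfSpace (g.nrm u) ↔ x ∈ halfSpace u := by
  simp only [halfSpace, Set.mem_ofPred_eq, lor_pt_nrm]

theorem image_segment (x y : H3) : g.pt '' segment x y = segment (g.pt x) (g.pt y) := by
  ext z
  rw [mem_image_pt]
  constructor
  · rintro ⟨a, b, ha, hb, h⟩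
    refine ⟨a, b, ha, hb, ?_⟩
    have := congrArg g.lin h
    simpa [pt, symm] using this
  · rintro ⟨a, b, ha, hb, h⟩
    refine ⟨a, b, ha, hb, ?_⟩
    have := congrArg g.lin.symm h
    simpa [pt, symm] using this

theorem isConvex_image {K : Set H3} (hK : IsConvex K) : IsConvex (g.pt '' K) := by
  rintro _ ⟨x, hx, rfl⟩ _ ⟨y, hy, rfl⟩
  rw [← image_segment]
  exact Set.image_mono (hK x hx y hy)

theorem image_symm_image (s : Set H3) : g.symm.pt '' (g.pt '' s) = s := by
  simp [Set.image_image]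

theorem image_image_symm (s : Set H3) : g.pt '' (g.symm.pt '' s) = s := by
  simp [Set.image_image]

theorem hull_image_subset (s : Set H3) : hull (g.pt '' s) ⊆ g.pt '' hull s := by
  intro x hx
  rw [mem_image_pt]
  rintro K ⟨hK, hs⟩
  have := hx (g.pt '' K) ⟨g.isConvex_image hK, Set.image_mono hs⟩
  rwa [mem_image_pt] at this

theorem image_hull (s : Set H3) : g.pt '' hull s = hull (g.pt '' s) := by
  refine Set.Subset.antisymm ?_ (g.hull_image_subset s)
  have := g.symm.hull_image_subset (g.pt '' s)
  rw [image_symm_image] at this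
  have := Set.image_mono (f := g.pt) this
  rwa [image_image_symm] at this

theorem isFaceWithNormal_image {k : ℕ} {K F : Set H3} {u : Normal}
    (h : IsFaceWithNormal k K F u) :
    IsFaceWithNormal k (g.pt '' K) (g.pt '' F) (g.nrm u) := by
  obtain ⟨h1, h2, h3⟩ := h
  refine ⟨?_, ?_, ?_⟩
  · rintro _ ⟨x, hx, rfl⟩
    exact g.pt_mem_halfSpace.2 (h1 hx)
  · ext x
    rw [h2, Set.mem_inter_iff, mem_image_pt, mem_image_pt, Set.mem_inter_iff,
      ← g.pt_mem_plane, pt_symm_pt]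
  · have e : (fun x : H3 => x.1) '' (g.pt '' F) = g.lin '' ((fun x : H3 => x.1) '' F) := by
      rw [Set.image_image, Set.image_image]; rfl
    have hmap := LinearEquiv.finrank_map_eq g.lin
      (Submodule.span ℝ ((fun x : H3 => x.1) '' F))
    rw [Submodule.map_span] at hmap
    rw [e, ← h3, ← hmap]
    rfl

theorem isFace_image {k : ℕ} {K F : Set H3} (h : IsFace k K F) :
    IsFace k (g.pt '' K) (g.pt '' F) := by
  obtain ⟨u, hu⟩ := h
  exact ⟨_, g.isFaceWithNormal_image hu⟩

theorem hdist_pt (x y : H3) : hdist (g.pt x) (g.pt y) = hdist x y := by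
  simp only [hdist, pt, g.map_lor]

theorem toward_pt (p x : H3) : toward (g.pt p) (g.pt x) = g.lin (toward p x) := by
  simp only [toward, pt, g.map_lor, map_add, map_smul]

theorem angle_pt (x p y : H3) : angle (g.pt x) (g.pt p) (g.pt y) = angle x p y := by
  simp only [angle, toward_pt, g.map_lor]

theorem isRegularRightAngledPolygon_image {n : ℕ} {F : Set H3}
    (h : IsRegularRightAngledPolygon n F) : IsRegularRightAngledPolygon n (g.pt '' F) := by
  obtain ⟨⟨u, hu⟩, v, hv, hF, hside, ⟨r, hr⟩, hang⟩ := h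
  refine ⟨⟨g.nrm u, ?_⟩, g.pt ∘ v, g.pt_injective.comp hv, ?_, ?_, ⟨r, ?_⟩, ?_⟩
  · rintro _ ⟨x, hx, rfl⟩
    exact g.pt_mem_plane.2 (hu hx)
  · rw [Set.range_comp, ← image_hull, ← hF]
  · intro i
    simp only [Function.comp_apply]
    rw [← image_segment]
    exact g.isFace_image (hside i)
  · intro i
    exact (g.hdist_pt _ _).trans (hr i)
  · intro i
    exact (g.angle_pt _ _ _).trans (hang i)

end Isom

open Filter Topology

/-! ### Right-angled cells -/

/-- The set of points behind all planes of a family. -/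
def cell (O : Set Normal) : Set H3 := ⋂ u ∈ O, halfSpace u

theorem mem_cell {O : Set Normal} {x : H3} : x ∈ cell O ↔ ∀ u ∈ O, lor x.1 u.1 ≤ 0 := by
  simp [cell, halfSpace]

theorem isConvex_cell (O : Set Normal) : IsConvex (cell O) := by
  intro x hx y hy z hz
  simp only [cell, Set.mem_iInter] at *
  exact fun u hu => isConvex_halfSpace u x (hx u hu) y (hy u hu) hz

/-- With `o = (1, 0, 0, 0)`, `x.1 0` is the hyperbolic cosine of the distance from `o` to `x`, while
for `u.1 0 ≥ 0` the distance from `o` to the plane has hyperbolic sine `u.1 0`. So `x` is nearer to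
`o` than the plane is. This reduces local statements about the family to normals of bounded time
component. -/
theorem lor_neg_of_zero_le {x : H3} {u : Normal} (h : x.1 0 ≤ u.1 0) : lor x.1 u.1 < 0 := by
  by_contra! hle
  have hx := x.sq_zero
  have hu := u.sq_zero
  have h2 := cauchy_schwarz₃ (x.1 1) (x.1 2) (x.1 3) (u.1 1) (u.1 2) (u.1 3)
  have hx0 := x.2.2
  simp only [lor] at hle
  have h3 : (x.1 0 * u.1 0) ^ 2 ≤ (x.1 1 * u.1 1 + x.1 2 * u.1 2 + x.1 3 * u.1 3) ^ 2 := by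
    apply pow_le_pow_left₀ (mul_nonneg hx0.le (hx0.le.trans h))
    linarith
  have h4 : x.1 1 ^ 2 + x.1 2 ^ 2 + x.1 3 ^ 2 = x.1 0 ^ 2 - 1 := by linarith
  rw [hu, h4] at h2
  nlinarith

/-- A family of half-spaces, all containing `b` in their interior and `(1, 0, 0, 0)`, any two of
which have orthogonal or disjoint bounding planes. -/
structure RightAngled (O : Set Normal) (b : H3) : Prop where
  pair : ∀ u ∈ O, ∀ v ∈ O, u = v ∨ lor u.1 v.1 = 0 ∨ lor u.1 v.1 ≤ -1
  nonneg : ∀ u ∈ O, 0 ≤ u.1 0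
  base : ∀ u ∈ O, lor b.1 u.1 < 0

/-- A point of a geodesic with initial point `x` and initial velocity `t`. -/
def geo (x : H3) (t : Fin 4 → ℝ) (hx : lor t x.1 = 0) (ht : lor t t = 1) (s : ℝ) : H3 :=
  ⟨Real.cosh s • x.1 + Real.sinh s • t, by
    have h : lor (Real.cosh s • x.1 + Real.sinh s • t) (Real.cosh s • x.1 + Real.sinh s • t) =
        -1 := by
      simp [lor_comm x.1 t, hx, ht, x.2.1]
      nlinarith [Real.cosh_sq s]
    refine ⟨h, pos_zero_of_lor_neg x (by rw [h]; norm_num) ?_⟩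
    simpa [hx, x.2.1] using Real.cosh_pos s⟩

theorem continuous_geo (x : H3) (t : Fin 4 → ℝ) (hx : lor t x.1 = 0) (ht : lor t t = 1) :
    Continuous (geo x t hx ht) := by
  unfold geo
  exact Continuous.subtype_mk (by fun_prop) _

theorem geo_zero (x : H3) (t : Fin 4 → ℝ) (hx : lor t x.1 = 0) (ht : lor t t = 1) :
    geo x t hx ht 0 = x := by
  ext1; simp [geo]

theorem continuous_lor_left (u : Fin 4 → ℝ) : Continuous fun y : H3 => lor y.1 u := by
  have h : ∀ i, Continuous fun y : H3 => y.1 i := fun i =>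
    (continuous_apply i).comp continuous_subtype_val
  unfold lor
  exact (((((h 0).mul continuous_const).neg.add ((h 1).mul continuous_const)).add
    ((h 2).mul continuous_const)).add ((h 3).mul continuous_const))

/-- Otherwise `p, u, v, w, t` would be five pairwise orthogonal non-null vectors in a space of
dimension four. -/
theorem eq_zero_of_orthogonal_frame {p : H3} {u v w : Normal} (hu : p ∈ plane u)
    (hv : p ∈ plane v) (hw : p ∈ plane w) (huv : lor u.1 v.1 = 0) (huw : lor u.1 w.1 = 0)
    (hvw : lor v.1 w.1 = 0) {t : Fin 4 → ℝ} (htp : lor t p.1 = 0) (htu : lor t u.1 = 0)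
    (htv : lor t v.1 = 0) (htw : lor t w.1 = 0) : t = 0 := by
  by_contra ht
  have hpos := lor_pos_of_orthogonal p htp ht
  have hpu : lor p.1 u.1 = 0 := hu
  have hpv : lor p.1 v.1 = 0 := hv
  have hpw : lor p.1 w.1 = 0 := hw
  have hli : LinearIndependent ℝ ![p.1, u.1, v.1, w.1, t] := by
    apply LinearMap.linearIndependent_of_isOrthoᵢ (B := lorForm)
    · intro i j hij
      change lor _ _ = 0
      fin_cases i <;> fin_cases j <;> first
        | exact absurd rfl hij
        | simp only [Fin.zero_eta, Fin.mk_one, Fin.reduceFinMk, Matrix.cons_val]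
          first
            | assumption
            | (rw [lor_comm]; assumption)
    · intro i
      change ¬ lor _ _ = 0
      fin_cases i <;> simp [p.2.1, u.2, v.2, w.2, hpos.ne']
  have := hli.fintype_card_le_finrank
  simp at this

theorem exists_ne_zero_orthogonal₃ (p q r : Fin 4 → ℝ) :
    ∃ t : Fin 4 → ℝ, t ≠ 0 ∧ lor t p = 0 ∧ lor t q = 0 ∧ lor t r = 0 := by
  obtain ⟨t, h0, ht⟩ := exists_ne_zero_orthogonal (Submodule.span ℝ (Set.range ![p, q, r]))
    (lt_of_le_of_lt (finrank_range_le_card ![p, q, r]) (by simp))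
  exact ⟨t, h0, ht _ (Submodule.subset_span ⟨0, rfl⟩), ht _ (Submodule.subset_span ⟨1, rfl⟩),
    ht _ (Submodule.subset_span ⟨2, rfl⟩)⟩

/-- The bisector of two orthogonal unit normals. -/
def bisector (u v : Normal) (h : lor u.1 v.1 = 0) : Normal :=
  ⟨(√2)⁻¹ • (u.1 + v.1), by
    have h2 : √2 ^ 2 = (2 : ℝ) := Real.sq_sqrt (by norm_num)
    have hs : (√2 : ℝ) ≠ 0 := by positivity
    simp only [lor_smul_left, lor_smul_right, lor_add_left, lor_add_right, u.2, v.2, h,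
      lor_comm v.1 u.1]
    field_simp
    linarith⟩

namespace RightAngled

variable {O : Set Normal} {b : H3}

theorem base_mem (hO : RightAngled O b) : b ∈ cell O :=
  mem_cell.2 fun u hu => (hO.base u hu).le

/-- Normals of bounded time component lie in a compact set, and distinct members of the family
cannot be close to each other because their product is nonpositive. -/
theorem finite_le (hO : RightAngled O b) (R : ℝ) : {u ∈ O | u.1 0 ≤ R}.Finite := by
  by_contra hinf
  have hinf : {u ∈ O | u.1 0 ≤ R}.Infinite := hinf
  set D : Set (Fin 4 → ℝ) := Subtype.val '' {u ∈ O | u.1 0 ≤ R}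
  have hD : D.Infinite := hinf.image Subtype.val_injective.injOn
  have hsub : D ⊆ Metric.closedBall 0 (1 + R) := by
    rintro _ ⟨u, ⟨huO, huR⟩, rfl⟩
    have h0 := hO.nonneg u huO
    have h1 := Normal.sq_zero u
    rw [mem_closedBall_zero_iff, pi_norm_le_iff_of_nonneg (by linarith)]
    intro i
    rw [Real.norm_eq_abs]
    apply abs_le_of_sq_le_sq _ (by linarith)
    fin_cases i <;> simp only [Fin.zero_eta, Fin.mk_one, Fin.reduceFinMk] <;>
      nlinarith [sq_nonneg (u.1 1), sq_nonneg (u.1 2), sq_nonneg (u.1 3)]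
  obtain ⟨x, -, hx⟩ := hD.exists_accPt_of_subset_isCompact (isCompact_closedBall _ _) hsub
  rw [accPt_iff_nhds] at hx
  obtain ⟨y, ⟨hyB, u, ⟨hu, -⟩, rfl⟩, hyx⟩ := hx (Metric.ball x (1 / 3))
    (Metric.ball_mem_nhds x (by norm_num))
  obtain ⟨z, ⟨hzB, v, ⟨hv, -⟩, rfl⟩, hzx⟩ := hx
    (Metric.ball x (min (1 / 3) (dist u.1 x)))
    (Metric.ball_mem_nhds x (lt_min (by norm_num) (dist_pos.2 hyx)))
  have hne : u ≠ v := by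
    rintro rfl
    exact absurd (lt_of_lt_of_le (Metric.mem_ball.1 hzB) (min_le_right _ _)) (lt_irrefl _)
  have hd : dist u.1 v.1 < 2 / 3 := by
    have h1 := Metric.mem_ball.1 hyB
    have h2 := lt_of_lt_of_le (Metric.mem_ball.1 hzB) (min_le_left _ _)
    have h3 := dist_triangle_right u.1 v.1 x
    linarith
  -- The difference has Lorentz square at least `2`, whereas its three space coordinates contribute
  -- at most `3 * (2 / 3) ^ 2 = 4 / 3`.
  have hlor : 2 ≤ lor (u.1 - v.1) (u.1 - v.1) := by
    have : lor u.1 v.1 ≤ 0 := by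
      rcases hO.pair u hu v hv with h | h | h
      · exact absurd h hne
      · exact h.le
      · linarith
    simp [u.2, v.2, lor_comm v.1 u.1]
    linarith
  have hi : ∀ i, (u.1 - v.1) i ^ 2 ≤ (2 / 3) ^ 2 := by
    intro i
    have := norm_le_pi_norm (u.1 - v.1) i
    rw [← dist_eq_norm, Real.norm_eq_abs] at this
    exact sq_le_sq.2 ((this.trans hd.le).trans (le_abs_self _))
  have h1 := hi 1
  have h2 := hi 2
  have h3 := hi 3
  unfold lor at hlor
  nlinarith [sq_nonneg ((u.1 - v.1) 0)]

/-- Strict inequalities persist uniformly over the family: only finitely many normals have small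
time component, and the others are negative near `x` in any case. -/
theorem eventually_neg (hO : RightAngled O b) (x : H3) :
    ∀ᶠ y in 𝓝 x, ∀ u ∈ O, lor x.1 u.1 < 0 → lor y.1 u.1 < 0 := by
  have h0 : ∀ᶠ y : H3 in 𝓝 x, y.1 0 < x.1 0 + 1 :=
    ((continuous_apply 0).comp continuous_subtype_val).continuousAt.eventually
      (gt_mem_nhds (lt_add_one (x.1 0)))
  have hfin : ∀ᶠ y : H3 in 𝓝 x, ∀ u ∈ {u ∈ O | u.1 0 ≤ x.1 0 + 1},
      lor x.1 u.1 < 0 → lor y.1 u.1 < 0 := by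
    rw [Filter.eventually_all_finite (hO.finite_le _)]
    intro u _
    by_cases h : lor x.1 u.1 < 0
    · filter_upwards [(continuous_lor_left u.1).continuousAt.eventually (gt_mem_nhds h)]
        with y hy _ using hy
    · exact Eventually.of_forall fun y hy => absurd hy h
  filter_upwards [h0, hfin] with y hy hyu u hu hxu
  rcases le_total (u.1 0) (x.1 0 + 1) with h | h
  · exact hyu u ⟨hu, h⟩ hxu
  · exact lor_neg_of_zero_le (hy.le.trans h)

theorem locallyFinite (hO : RightAngled O b) : LocallyFinite fun u : O => plane u.1 := by
  intro x
  refine ⟨{y : H3 | y.1 0 < x.1 0 + 1},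
    ((continuous_apply 0).comp continuous_subtype_val).continuousAt.eventually
      (gt_mem_nhds (lt_add_one (x.1 0))), ?_⟩
  refine ((hO.finite_le (x.1 0 + 1)).preimage Subtype.val_injective.injOn).subset ?_
  rintro u ⟨y, hyu, hy⟩
  refine ⟨u.2, ?_⟩
  by_contra! hlt
  have hy' : y.1 0 < x.1 0 + 1 := hy
  have : lor y.1 u.1.1 < 0 := lor_neg_of_zero_le (hy'.le.trans hlt.le)
  exact this.ne hyu

theorem isConvexPolyhedron (hO : RightAngled O b) : IsConvexPolyhedron (cell O) where
  convex := isConvex_cell O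
  interior_nonempty := by
    refine ⟨b, mem_interior_iff_mem_nhds.2 ?_⟩
    filter_upwards [hO.eventually_neg b] with y hy
    exact mem_cell.2 fun u hu => (hy u hu (hO.base u hu)).le
  halfSpaces := ⟨O, hO.locallyFinite, rfl⟩

/-- Two planes of the family that meet are orthogonal. -/
theorem orthogonal_of_mem (hO : RightAngled O b) {u v : Normal} (hu : u ∈ O) (hv : v ∈ O)
    (huv : u ≠ v) {x : H3} (hxu : x ∈ plane u) (hxv : x ∈ plane v) : lor u.1 v.1 = 0 := by
  rcases hO.pair u hu v hv with h | h | h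
  · exact absurd h huv
  · exact h
  · exfalso
    have hxu : lor x.1 u.1 = 0 := hxu
    have hxv : lor x.1 v.1 = 0 := hxv
    have hb := hO.base u hu
    have hb' := hO.base v hv
    -- If the product were at most `-1`, the tangent vector `u + v` at `x` would have square at most
    -- `0`; it is nonzero because both normals are negative at `b`.
    have h0 : lor (u.1 + v.1) x.1 = 0 := by
      simp [lor_comm _ x.1, hxu, hxv]
    have hne : u.1 + v.1 ≠ 0 := by
      intro h1
      have : lor b.1 (u.1 + v.1) = 0 := by simp [h1]
      rw [lor_add_right] at this
      linarith
    have := lor_pos_of_orthogonal x h0 hne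
    simp [u.2, v.2, lor_comm v.1 u.1] at this
    linarith

/-! ### Faces, edges and vertices of a right-angled cell -/

/-- A tangent vector at a point of a face that is tangent to all planes of the family through this
point is tangent to the face. -/
theorem mem_span_of_tangent (hO : RightAngled O b) {w : Normal} (hw : cell O ⊆ halfSpace w)
    {x : H3} (hx : x ∈ cell O ∩ plane w) {t : Fin 4 → ℝ} (htx : lor t x.1 = 0)
    (ht : ∀ u ∈ O, x ∈ plane u → lor t u.1 = 0) :
    t ∈ Submodule.span ℝ ((fun x : H3 => x.1) '' (cell O ∩ plane w)) := by
  rcases eq_or_ne t 0 with rfl | ht0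
  · exact zero_mem _
  have hpos := lor_pos_of_orthogonal x htx ht0
  set r := √(lor t t) with hr
  have hr0 : 0 < r := Real.sqrt_pos.2 hpos
  have hr2 : r ^ 2 = lor t t := Real.sq_sqrt hpos.le
  have hsx : lor (r⁻¹ • t) x.1 = 0 := by simp [htx]
  have hs1 : lor (r⁻¹ • t) (r⁻¹ • t) = 1 := by
    simp only [lor_smul_left, lor_smul_right, ← hr2]
    field_simp
  set γ := geo x (r⁻¹ • t) hsx hs1 with hγ
  have hγ0 : Tendsto γ (𝓝 0) (𝓝 x) := by
    have := (continuous_geo x (r⁻¹ • t) hsx hs1).tendsto 0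
    rwa [geo_zero] at this
  have hmem : ∀ᶠ s in 𝓝 (0 : ℝ), γ s ∈ cell O := by
    filter_upwards [hγ0.eventually (hO.eventually_neg x)] with s hs
    refine mem_cell.2 fun u hu => ?_
    rcases (mem_cell.1 hx.1 u hu).lt_or_eq with h | h
    · exact (hs u hu h).le
    · have := ht u hu h
      simp [hγ, geo, h, this]
  have hmem' : ∀ᶠ s in 𝓝 (0 : ℝ), γ (-s) ∈ cell O := by
    have : Tendsto (fun s : ℝ => -s) (𝓝 0) (𝓝 0) := by
      simpa using (continuous_neg.tendsto (0 : ℝ))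
    exact this.eventually hmem
  obtain ⟨s, ⟨h1, h2⟩, hs⟩ := ((hmem.and hmem').filter_mono nhdsWithin_le_nhds |>.and
    (self_mem_nhdsWithin : Set.Ioi (0 : ℝ) ∈ 𝓝[>] (0 : ℝ))).exists
  -- The geodesic stays in the cell for short times in both directions. Supporting the cell along it
  -- forces the derivative of the product with `w` to vanish, so the geodesic stays in the face.
  have hxw : lor x.1 w.1 = 0 := hx.2
  have l1 : lor (γ s).1 w.1 ≤ 0 := hw h1
  have l2 : lor (γ (-s)).1 w.1 ≤ 0 := hw h2
  have hγw : lor (γ s).1 w.1 = 0 := by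
    simp only [hγ, geo, lor_add_left, lor_smul_left, hxw, Real.sinh_neg] at l1 l2 ⊢
    linarith
  have hγs : (γ s).1 ∈ Submodule.span ℝ ((fun x : H3 => x.1) '' (cell O ∩ plane w)) :=
    Submodule.subset_span ⟨γ s, ⟨h1, hγw⟩, rfl⟩
  have hxs : x.1 ∈ Submodule.span ℝ ((fun x : H3 => x.1) '' (cell O ∩ plane w)) :=
    Submodule.subset_span ⟨x, hx, rfl⟩
  have hsinh : Real.sinh s ≠ 0 := (Real.sinh_pos_iff.2 hs).ne'
  have e : t = (r * (Real.sinh s)⁻¹) • ((γ s).1 - Real.cosh s • x.1) := by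
    simp only [hγ, geo, add_sub_cancel_left, smul_smul]
    have : r * (Real.sinh s)⁻¹ * (Real.sinh s * r⁻¹) = 1 := by field_simp
    rw [this, one_smul]
  rw [e]
  exact Submodule.smul_mem _ _ (sub_mem hγs (Submodule.smul_mem _ _ hxs))

/-- A tangent vector orthogonal to every active normal would lie in the span of the face; being also
orthogonal to that span, it would be null, but tangent spaces are spacelike. Applied to suitable
`t`, this produces as many active normals as the codimension of the face. -/
theorem exists_normal_not_orthogonal (hO : RightAngled O b) {w : Normal}
    (hw : cell O ⊆ halfSpace w) {x : H3} (hx : x ∈ cell O ∩ plane w) {t : Fin 4 → ℝ}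
    (ht0 : t ≠ 0) (ht : ∀ y ∈ cell O ∩ plane w, lor t y.1 = 0) :
    ∃ u ∈ O, x ∈ plane u ∧ lor t u.1 ≠ 0 := by
  by_contra! h
  have hmem := hO.mem_span_of_tangent hw hx (ht x hx) h
  have : t ∈ lorForm.orthogonal
      (Submodule.span ℝ ((fun x : H3 => x.1) '' (cell O ∩ plane w))) := by
    rw [mem_orthogonal_span]
    rintro _ ⟨y, hy, rfl⟩
    exact ht y hy
  have h0 : lor t t = 0 := LinearMap.BilinForm.mem_orthogonal_iff.1 this t hmem
  exact (lor_pos_of_orthogonal x (ht x hx) ht0).ne' h0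

/-- The normal of a two-dimensional face is unique. -/
theorem eq_normal_of_subset (hO : RightAngled O b) {F : Set H3} {w u : Normal}
    (hF : IsFaceWithNormal 2 (cell O) F w) (hu : F ⊆ plane u) (hub : lor b.1 u.1 < 0) :
    u = w := by
  obtain ⟨h1, h2, h3⟩ := hF
  set S := Submodule.span ℝ ((fun x : H3 => x.1) '' F)
  have hr : Module.finrank ℝ (lorForm.orthogonal S) = 1 := by
    rw [finrank_orthogonal, h3]
  have hmem : ∀ v : Normal, F ⊆ plane v → v.1 ∈ lorForm.orthogonal S := by
    intro v hv
    rw [mem_orthogonal_span]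
    rintro _ ⟨y, hy, rfl⟩
    exact (lor_comm _ _).trans (hv hy)
  have hw' := hmem w (h2 ▸ Set.inter_subset_right)
  have hw0 : (⟨w.1, hw'⟩ : lorForm.orthogonal S) ≠ 0 := by
    intro h
    have h' : w.1 = 0 := congrArg Subtype.val h
    have := w.2
    simp [h'] at this
  obtain ⟨c, hc⟩ := exists_smul_eq_of_finrank_eq_one hr hw0 ⟨u.1, hmem u hu⟩
  have hc' : u.1 = c • w.1 := (congrArg Subtype.val hc).symm
  have hc2 : c * c = 1 := by
    have := u.2
    rw [hc'] at this
    simpa [w.2] using this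
  have hwb : lor b.1 w.1 ≤ 0 := h1 hO.base_mem
  have hc1 : c = 1 := by
    rcases mul_self_eq_one_iff.1 hc2 with h | h
    · exact h
    · rw [hc', h] at hub
      simp at hub
      linarith
  ext1
  rw [hc', hc1, one_smul]

theorem nonempty_of_finrank {F : Set H3} {k : ℕ}
    (h : Module.finrank ℝ (Submodule.span ℝ ((fun x : H3 => x.1) '' F)) = k + 1) :
    F.Nonempty := by
  by_contra hne
  rw [Set.not_nonempty_iff_eq_empty] at hne
  rw [hne, Set.image_empty, Submodule.span_empty, finrank_bot] at h
  omega

/-- A relative interior point of the face has an active member `u` of the family. The plane of `u`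
then contains the whole face, and the normal of a two-dimensional face is unique. -/
theorem normal_mem (hO : RightAngled O b) {F : Set H3} {w : Normal}
    (hF : IsFaceWithNormal 2 (cell O) F w) : w ∈ O := by
  have hne := nonempty_of_finrank hF.2.2
  have hFe := hF.2.1
  have hconv : IsConvex F := hFe ▸ (isConvex_cell O).inter (isConvex_plane w)
  obtain ⟨x, hx, hrel⟩ := hconv.exists_relint hne
  have hw0 : w.1 ≠ 0 := by
    intro h
    have := w.2
    simp [h] at this
  obtain ⟨u, hu, hxu, -⟩ := hO.exists_normal_not_orthogonal hF.1 (hFe ▸ hx) hw0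
    fun y hy => (lor_comm _ _).trans hy.2
  have hsub : F ⊆ halfSpace u := fun y hy => mem_cell.1 (hFe ▸ hy : y ∈ cell O ∩ plane w).1 u hu
  rw [← hO.eq_normal_of_subset hF (hrel u hsub hxu) (hO.base u hu)]
  exact hu

/-- At a vertex, exactly three planes of the family meet, and they are pairwise orthogonal. -/
theorem exists_three_normals (hO : RightAngled O b) {p : H3} (hp : IsFace 0 (cell O) {p}) :
    ∃ u ∈ O, ∃ v ∈ O, ∃ w ∈ O, u ≠ v ∧ u ≠ w ∧ v ≠ w ∧
      {z ∈ O | p ∈ plane z} = {u, v, w} := by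
  obtain ⟨z, hz, hpe, -⟩ := hp
  have hpz : p ∈ cell O ∩ plane z := hpe ▸ Set.mem_singleton p
  -- Choosing `t` orthogonal to the normals already found makes the next active normal different
  -- from them.
  have key : ∀ q r : Fin 4 → ℝ, ∃ u ∈ O, p ∈ plane u ∧ u.1 ≠ q ∧ u.1 ≠ r := by
    intro q r
    obtain ⟨t, ht0, htp, htq, htr⟩ := exists_ne_zero_orthogonal₃ p.1 q r
    obtain ⟨u, hu, hpu, htu⟩ := hO.exists_normal_not_orthogonal hz hpz ht0 (by
      intro y hy
      rw [← hpe, Set.mem_singleton_iff] at hy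
      rw [hy, htp])
    exact ⟨u, hu, hpu, by rintro rfl; exact htu htq, by rintro rfl; exact htu htr⟩
  obtain ⟨u, hu, hpu, -⟩ := key 0 0
  obtain ⟨v, hv, hpv, hvu, -⟩ := key u.1 0
  obtain ⟨w, hw, hpw, hwu, hwv⟩ := key u.1 v.1
  have huv : u ≠ v := fun h => hvu (h ▸ rfl)
  have huw : u ≠ w := fun h => hwu (h ▸ rfl)
  have hvw : v ≠ w := fun h => hwv (h ▸ rfl)
  refine ⟨u, hu, v, hv, w, hw, huv, huw, hvw, ?_⟩
  ext z
  rw [Set.mem_insert_iff, Set.mem_insert_iff, Set.mem_singleton_iff]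
  constructor
  · rintro ⟨hz, hpz⟩
    by_contra! hne
    have h0 := eq_zero_of_orthogonal_frame hpu hpv hpw (hO.orthogonal_of_mem hu hv huv hpu hpv)
      (hO.orthogonal_of_mem hu hw huw hpu hpw) (hO.orthogonal_of_mem hv hw hvw hpv hpw)
      (t := z.1) ((lor_comm _ _).trans hpz) (hO.orthogonal_of_mem hz hu hne.1 hpz hpu)
      (hO.orthogonal_of_mem hz hv hne.2.1 hpz hpv) (hO.orthogonal_of_mem hz hw hne.2.2 hpz hpw)
    have := z.2
    simp [h0] at this
  · rintro (rfl | rfl | rfl)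
    · exact ⟨hu, hpu⟩
    · exact ⟨hv, hpv⟩
    · exact ⟨hw, hpw⟩

/-- An edge is the intersection of the cell with two planes of the family. -/
theorem exists_eq_of_isFace_one (hO : RightAngled O b) {E : Set H3} (hE : IsFace 1 (cell O) E) :
    ∃ u ∈ O, ∃ v ∈ O, u ≠ v ∧ E = cell O ∩ plane u ∩ plane v := by
  obtain ⟨z, hz, hEe, hr⟩ := hE
  have hne := nonempty_of_finrank hr
  have hconv : IsConvex E := hEe ▸ (isConvex_cell O).inter (isConvex_plane z)
  obtain ⟨x, hx, hrel⟩ := hconv.exists_relint hne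
  set S := Submodule.span ℝ ((fun x : H3 => x.1) '' E) with hS
  have key : ∀ q : Fin 4 → ℝ, ∃ u ∈ O, x ∈ plane u ∧ u.1 ≠ q := by
    intro q
    obtain ⟨t, ht0, ht⟩ := exists_ne_zero_orthogonal (S ⊔ Submodule.span ℝ {q}) (by
      have h1 := Submodule.finrank_add_le_finrank_add_finrank S (Submodule.span ℝ {q})
      have h2 := finrank_span_le_card (R := ℝ) ({q} : Set (Fin 4 → ℝ))
      rw [Set.toFinset_singleton, Finset.card_singleton] at h2
      omega)
    obtain ⟨u, hu, hxu, htu⟩ := hO.exists_normal_not_orthogonal hz (hEe ▸ hx) ht0 (by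
      intro y hy
      exact ht _ (Submodule.mem_sup_left (Submodule.subset_span ⟨y, hEe ▸ hy, rfl⟩)))
    refine ⟨u, hu, hxu, ?_⟩
    rintro rfl
    exact htu (ht _ (Submodule.mem_sup_right (Submodule.mem_span_singleton_self _)))
  obtain ⟨u, hu, hxu, -⟩ := key 0
  obtain ⟨v, hv, hxv, hvu⟩ := key u.1
  have huv : u ≠ v := fun h => hvu (h ▸ rfl)
  have hplane : ∀ u ∈ O, x ∈ plane u → E ⊆ plane u := fun u hu hxu =>
    hrel u (fun y hy => mem_cell.1 (hEe ▸ hy : y ∈ cell O ∩ plane z).1 u hu) hxu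
  have hEu := hplane u hu hxu
  have hEv := hplane v hv hxv
  refine ⟨u, hu, v, hv, huv, ?_⟩
  have horth := hO.orthogonal_of_mem hu hv huv hxu hxv
  have hli : LinearIndependent ℝ ![u.1, v.1] := by
    apply LinearMap.linearIndependent_of_isOrthoᵢ (B := lorForm)
    · intro i j hij
      change lor _ _ = 0
      fin_cases i <;> fin_cases j <;> simp_all [lor_comm v.1 u.1]
    · intro i
      change ¬ lor _ _ = 0
      fin_cases i <;> simp [u.2, v.2]
  have hSle : S ≤ lorForm.orthogonal (Submodule.span ℝ (Set.range ![u.1, v.1])) := by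
    rw [hS, Submodule.span_le]
    rintro _ ⟨y, hy, rfl⟩
    rw [SetLike.mem_coe, mem_orthogonal_span]
    rintro _ ⟨i, rfl⟩
    fin_cases i
    · exact hEu hy
    · exact hEv hy
  -- Both spaces have dimension two, so the span of the edge is cut out by the two normals.
  have hSeq := Submodule.eq_of_le_of_finrank_eq hSle (by
    rw [finrank_orthogonal, finrank_span_eq_card hli, hr, Fintype.card_fin])
  apply Set.Subset.antisymm
  · intro y hy
    exact ⟨⟨(hEe ▸ hy : y ∈ cell O ∩ plane z).1, hEu hy⟩, hEv hy⟩
  · rintro y ⟨⟨hy, hyu⟩, hyv⟩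
    have hyS : y.1 ∈ S := by
      rw [hSeq, mem_orthogonal_span]
      rintro _ ⟨i, rfl⟩
      fin_cases i
      · exact hyu
      · exact hyv
    have hSz : S ≤ LinearMap.ker (lorForm z.1) := by
      rw [hS, Submodule.span_le]
      rintro _ ⟨y, hy, rfl⟩
      exact (lor_comm _ _).trans (hEe ▸ hy : y ∈ cell O ∩ plane z).2
    rw [hEe]
    exact ⟨hy, (lor_comm _ _).trans (hSz hyS)⟩

/-- An intersection of two faces that is a side of one of them is an edge of the cell. -/
theorem isFace_one_of_side {u v : Normal} (hu : u ∈ O) (hv : v ∈ O)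
    (huv : lor u.1 v.1 = 0)
    (h : IsFace 1 (cell O ∩ plane u) (cell O ∩ plane u ∩ plane v)) :
    IsFace 1 (cell O) (cell O ∩ plane u ∩ plane v) := by
  obtain ⟨-, -, -, hr⟩ := h
  have hs : 0 < (√2)⁻¹ := by positivity
  -- A sum of two nonpositive numbers vanishes only if both do, so on the cell the plane of the
  -- bisector picks out the intersection of the two planes.
  refine ⟨bisector u v huv, ?_, ?_, hr⟩
  · intro x hx
    have h1 := mem_cell.1 hx u hu
    have h2 := mem_cell.1 hx v hv
    change lor x.1 ((√2)⁻¹ • (u.1 + v.1)) ≤ 0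
    rw [lor_smul_right, lor_add_right]
    exact mul_nonpos_of_nonneg_of_nonpos hs.le (by linarith)
  · ext x
    constructor
    · rintro ⟨⟨hx, hxu⟩, hxv⟩
      refine ⟨hx, ?_⟩
      change lor x.1 ((√2)⁻¹ • (u.1 + v.1)) = 0
      rw [lor_smul_right, lor_add_right, show lor x.1 u.1 = 0 from hxu,
        show lor x.1 v.1 = 0 from hxv, add_zero, mul_zero]
    · rintro ⟨hx, hxw⟩
      have h1 := mem_cell.1 hx u hu
      have h2 := mem_cell.1 hx v hv
      have h3 : lor x.1 ((√2)⁻¹ • (u.1 + v.1)) = 0 := hxw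
      rw [lor_smul_right, lor_add_right, mul_eq_zero] at h3
      have h3 := h3.resolve_left hs.ne'
      exact ⟨⟨hx, show lor x.1 u.1 = 0 by linarith⟩, show lor x.1 v.1 = 0 by linarith⟩

theorem ncard_faces_and_edges (hO : RightAngled O b)
    (hface : ∀ u ∈ O, IsFace 2 (cell O) (cell O ∩ plane u))
    (hside : ∀ u ∈ O, ∀ v ∈ O, lor u.1 v.1 = 0 →
      IsFace 1 (cell O ∩ plane u) (cell O ∩ plane u ∩ plane v))
    {p : H3} (hp : IsFace 0 (cell O) {p}) :
    {F | IsFace 2 (cell O) F ∧ p ∈ F}.ncard = 3 ∧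
      {E | IsFace 1 (cell O) E ∧ p ∈ E}.ncard = 3 := by
  obtain ⟨u, hu, v, hv, w, hw, huv, huw, hvw, hT⟩ := hO.exists_three_normals hp
  have hpc : p ∈ cell O := by
    obtain ⟨z, hz, hpe, -⟩ := hp
    exact (hpe ▸ Set.mem_singleton p : p ∈ cell O ∩ plane z).1
  have hplane : ∀ z, z = u ∨ z = v ∨ z = w → p ∈ plane z := by
    intro z hz
    have : z ∈ {z ∈ O | p ∈ plane z} := by rw [hT]; simpa using hz
    exact this.2
  have hpu := hplane u (by simp)
  have hpv := hplane v (by simp)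
  have hpw := hplane w (by simp)
  have ouv := hO.orthogonal_of_mem hu hv huv hpu hpv
  have ouw := hO.orthogonal_of_mem hu hw huw hpu hpw
  have ovw := hO.orthogonal_of_mem hv hw hvw hpv hpw
  have hmem : ∀ z ∈ O, p ∈ plane z → z = u ∨ z = v ∨ z = w := by
    intro z hz hpz
    have : z ∈ {z ∈ O | p ∈ plane z} := ⟨hz, hpz⟩
    rw [hT] at this
    simpa using this
  have hinj : ∀ z ∈ O, ∀ z' ∈ O, cell O ∩ plane z = cell O ∩ plane z' → z = z' := by
    intro z hz z' hz' h
    obtain ⟨y, hy⟩ := hface z hz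
    have e1 := hO.eq_normal_of_subset hy Set.inter_subset_right (hO.base z hz)
    have e2 := hO.eq_normal_of_subset (u := z') hy (h ▸ Set.inter_subset_right) (hO.base z' hz')
    rw [e1, e2]
  constructor
  · rw [Set.ncard_eq_three]
    refine ⟨cell O ∩ plane u, cell O ∩ plane v, cell O ∩ plane w,
      fun h => huv (hinj u hu v hv h), fun h => huw (hinj u hu w hw h),
      fun h => hvw (hinj v hv w hw h), ?_⟩
    ext F
    simp only [Set.mem_ofPred_eq, Set.mem_insert_iff, Set.mem_singleton_iff]
    constructor
    · rintro ⟨⟨z, hz⟩, hpF⟩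
      have hzO := hO.normal_mem hz
      rw [hz.2.1] at hpF ⊢
      rcases hmem z hzO hpF.2 with rfl | rfl | rfl <;> simp
    · rintro (rfl | rfl | rfl)
      exacts [⟨hface u hu, hpc, hpu⟩, ⟨hface v hv, hpc, hpv⟩, ⟨hface w hw, hpc, hpw⟩]
  -- The three active planes meet only at `p`, so no edge lies in all of them. This separates the
  -- three pairwise intersections.
  · have hcontra : ∀ E, IsFace 1 (cell O) E → E ⊆ plane u → E ⊆ plane v → ¬ E ⊆ plane w := by
      rintro E ⟨z, -, -, hr⟩ h1 h2 h3
      have hEp : E ⊆ {p} := by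
        intro y hy
        have yu : lor y.1 u.1 = 0 := h1 hy
        have yv : lor y.1 v.1 = 0 := h2 hy
        have yw : lor y.1 w.1 = 0 := h3 hy
        have pu : lor p.1 u.1 = 0 := hpu
        have pv : lor p.1 v.1 = 0 := hpv
        have pw : lor p.1 w.1 = 0 := hpw
        -- The vector `t` is the projection of `y` to the tangent space at `p`.
        have := eq_zero_of_orthogonal_frame hpu hpv hpw ouv ouw ovw
          (t := y.1 + lor y.1 p.1 • p.1) (by simp [p.2.1]) (by simp [yu, pu]) (by simp [yv, pv])
          (by simp [yw, pw])
        exact H3.eq_of_smul (r := -lor y.1 p.1) (by rw [neg_smul]; exact eq_neg_of_add_eq_zero_left this)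
      have h1 : Submodule.span ℝ ((fun x : H3 => x.1) '' E) ≤ Submodule.span ℝ {p.1} := by
        apply Submodule.span_mono
        rintro _ ⟨y, hy, rfl⟩
        rw [hEp hy]
        rfl
      have h2 := Submodule.finrank_mono h1
      have h3 := finrank_span_le_card (R := ℝ) ({p.1} : Set (Fin 4 → ℝ))
      rw [Set.toFinset_singleton, Finset.card_singleton] at h3
      omega
    have face_uv := isFace_one_of_side hu hv ouv (hside u hu v hv ouv)
    have face_uw := isFace_one_of_side hu hw ouw (hside u hu w hw ouw)
    have face_vw := isFace_one_of_side hv hw ovw (hside v hv w hw ovw)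
    have su : ∀ z z' : Normal, cell O ∩ plane z ∩ plane z' ⊆ plane z := fun z z' x hx => hx.1.2
    have sv : ∀ z z' : Normal, cell O ∩ plane z ∩ plane z' ⊆ plane z' := fun z z' x hx => hx.2
    rw [Set.ncard_eq_three]
    refine ⟨cell O ∩ plane u ∩ plane v, cell O ∩ plane u ∩ plane w, cell O ∩ plane v ∩ plane w,
      fun h => hcontra _ face_uv (su _ _) (sv _ _) (h ▸ sv _ _),
      fun h => hcontra _ face_uv (su _ _) (sv _ _) (h ▸ sv _ _),
      fun h => hcontra _ face_uw (su _ _) (h ▸ su _ _) (sv _ _), ?_⟩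
    ext E
    simp only [Set.mem_ofPred_eq, Set.mem_insert_iff, Set.mem_singleton_iff]
    constructor
    · rintro ⟨hE, hpE⟩
      obtain ⟨z, hz, z', hz', hne, rfl⟩ := hO.exists_eq_of_isFace_one hE
      have hcomm : ∀ z z' : Normal,
          cell O ∩ plane z ∩ plane z' = cell O ∩ plane z' ∩ plane z :=
        fun z z' => Set.inter_right_comm _ _ _
      rcases hmem z hz hpE.1.2 with rfl | rfl | rfl <;>
        rcases hmem z' hz' hpE.2 with rfl | rfl | rfl <;>
        first
          | exact absurd rfl hne
          | simp
          | (rw [hcomm]; simp)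
    · rintro (rfl | rfl | rfl)
      exacts [⟨face_uv, ⟨hpc, hpu⟩, hpv⟩, ⟨face_uw, ⟨hpc, hpu⟩, hpw⟩, ⟨face_vw, ⟨hpc, hpv⟩, hpw⟩]

end RightAngled

/-! ### The right-angled regular polygon -/

theorem isConvex_hull (s : Set H3) : IsConvex (hull s) := by
  intro x hx y hy z hz K hK
  exact hK.1 x (hx K hK) y (hy K hK) hz

theorem subset_hull (s : Set H3) : s ⊆ hull s := fun _ hx _ hK => hK.2 hx

theorem hull_subset {s K : Set H3} (hK : IsConvex K) (hs : s ⊆ K) : hull s ⊆ K :=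
  fun _ hx => hx K ⟨hK, hs⟩

/-- Adjoining `0` to the cone admits coefficients that vanish, as happens for points on the boundary
of a sector. -/
theorem IsConvex.add_mem_insert_cone {K : Set H3} (hK : IsConvex K) {y z : Fin 4 → ℝ}
    (hy : y ∈ insert 0 (cone K)) (hz : z ∈ insert 0 (cone K)) : y + z ∈ insert 0 (cone K) := by
  rcases hy with rfl | hy
  · simpa using hz
  rcases hz with rfl | hz
  · simpa using Or.inr hy
  exact Or.inr (hK.add_mem_cone hy hz)

theorem smul_mem_insert_cone {K : Set H3} {y : Fin 4 → ℝ} (hy : y ∈ cone K) {r : ℝ}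
    (hr : 0 ≤ r) : r • y ∈ insert 0 (cone K) := by
  rcases hr.eq_or_lt with rfl | hr
  · left; simp
  · exact Or.inr (smul_mem_cone hy hr)

section Polygon

variable (n : ℕ)

/-- Half of the central angle of a side of a regular `n`-gon. -/
def theta : ℝ := Real.pi / n

/-- The spatial length of the side normals. -/
def normB : ℝ := 1 / (√2 * Real.sin (theta n))

/-- The time component of the side normals. -/
def normA : ℝ := √(normB n ^ 2 - 1)

variable [hn : Fact (6 ≤ n)]

theorem natCast_pos : (0 : ℝ) < n := by exact_mod_cast lt_of_lt_of_le (by norm_num) hn.out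

theorem mul_theta : (n : ℝ) * theta n = Real.pi := by
  have := natCast_pos n
  rw [theta]
  field_simp

theorem theta_pos : 0 < theta n := div_pos Real.pi_pos (natCast_pos n)

theorem theta_le : theta n ≤ Real.pi / 6 := by
  rw [theta]
  have : (6 : ℝ) ≤ n := by exact_mod_cast hn.out
  exact div_le_div_of_nonneg_left Real.pi_pos.le (by norm_num) this

theorem sin_theta_pos : 0 < Real.sin (theta n) :=
  Real.sin_pos_of_pos_of_lt_pi (theta_pos n) (by linarith [theta_le n, Real.pi_pos])

theorem sin_theta_le : Real.sin (theta n) ≤ 1 / 2 := by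
  rw [← Real.sin_pi_div_six]
  exact Real.sin_le_sin_of_le_of_le_pi_div_two (by linarith [theta_pos n, Real.pi_pos])
    (by linarith [Real.pi_pos]) (theta_le n)

theorem cos_theta_pos : 0 < Real.cos (theta n) :=
  Real.cos_pos_of_mem_Ioo ⟨by linarith [theta_pos n, Real.pi_pos],
    by linarith [theta_le n, Real.pi_pos]⟩

theorem cos_theta_sq : 3 / 4 ≤ Real.cos (theta n) ^ 2 := by
  nlinarith [Real.sin_sq_add_cos_sq (theta n), sin_theta_le n, sin_theta_pos n]

theorem normB_pos : 0 < normB n := by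
  have := sin_theta_pos n
  rw [normB]
  positivity

/-- Given `normA n ^ 2 = normB n ^ 2 - 1`, this is the orthogonality of consecutive side normals,
that is, the right angle of the polygon. -/
theorem normB_sq_mul : 2 * normB n ^ 2 * Real.sin (theta n) ^ 2 = 1 := by
  have := sin_theta_pos n
  have h2 : √2 ^ 2 = (2 : ℝ) := Real.sq_sqrt (by norm_num)
  rw [normB, div_pow, mul_pow, h2]
  field_simp

/-- This is where `6 ≤ n` matters: it yields `1 ≤ normA n`, so the vector fixed by the tiling group
is not timelike. -/
theorem two_le_normB_sq : 2 ≤ normB n ^ 2 := by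
  have h := normB_sq_mul n
  have h1 : Real.sin (theta n) ^ 2 ≤ 1 / 4 := by
    nlinarith [sin_theta_le n, sin_theta_pos n]
  nlinarith [sq_nonneg (normB n)]

theorem normA_sq : normA n ^ 2 = normB n ^ 2 - 1 :=
  Real.sq_sqrt (by linarith [two_le_normB_sq n])

theorem one_le_normA : 1 ≤ normA n := by
  rw [normA]
  exact Real.one_le_sqrt.2 (by linarith [two_le_normB_sq n])

theorem normA_pos : 0 < normA n := one_pos.trans_le (one_le_normA n)

/-! Sines of multiples of `theta n` -/

theorem sin_int_mul_theta_add (m q : ℤ) :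
    Real.sin (((m + n * q : ℤ) : ℝ) * theta n) = (-1) ^ q * Real.sin (m * theta n) := by
  rw [← Real.sin_add_int_mul_pi, ← mul_theta n]
  congr 1
  push_cast
  ring

theorem sin_int_mul_theta_nonneg {r : ℤ} (h0 : 0 ≤ r) (h : r ≤ n) :
    0 ≤ Real.sin (r * theta n) := by
  have h0' : (0 : ℝ) ≤ r := by exact_mod_cast h0
  have h' : (r : ℝ) ≤ n := by exact_mod_cast h
  apply Real.sin_nonneg_of_nonneg_of_le_pi (mul_nonneg h0' (theta_pos n).le)
  rw [← mul_theta n]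
  exact mul_le_mul_of_nonneg_right h' (theta_pos n).le

theorem sin_int_mul_theta_eq_zero {m : ℤ} (h : Real.sin (m * theta n) = 0) : (n : ℤ) ∣ m := by
  obtain ⟨q, hq⟩ := Real.sin_eq_zero_iff.1 h
  rw [← mul_theta n, ← mul_assoc] at hq
  have := mul_right_cancel₀ (theta_pos n).ne' hq
  exact ⟨q, by rw [mul_comm]; exact_mod_cast this.symm⟩

theorem neg_one_zpow_mul_self (q : ℤ) : ((-1 : ℝ) ^ q) * (-1) ^ q = 1 := by
  rw [← mul_zpow]; simp

/-- Among the odd multiples of `theta n`, the angle `theta n` has the largest cosine. -/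
theorem cos_odd_mul_theta_le (m : ℤ) : Real.cos ((2 * m + 1) * theta n) ≤ Real.cos (theta n) := by
  have key : Real.cos (theta n) - Real.cos ((2 * m + 1) * theta n) =
      2 * (Real.sin (((m + 1 : ℤ) : ℝ) * theta n) * Real.sin (m * theta n)) := by
    rw [Real.cos_sub_cos,
      show (theta n + (2 * m + 1) * theta n) / 2 = ((m + 1 : ℤ) : ℝ) * theta n by push_cast; ring,
      show (theta n - (2 * m + 1) * theta n) / 2 = -(m * theta n) by ring, Real.sin_neg]
    ring
  have hpos : (0 : ℤ) < n := by exact_mod_cast lt_of_lt_of_le (by norm_num) hn.out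
  have h1 := Int.emod_nonneg m hpos.ne'
  have h2 := Int.emod_lt_of_pos m hpos
  have e := Int.emod_add_mul_ediv m n
  -- Reducing `m` modulo `n` changes both sines by the same sign, after which both arguments lie in
  -- `[0, π]`.
  have : 0 ≤ Real.sin (((m + 1 : ℤ) : ℝ) * theta n) * Real.sin (m * theta n) := by
    rw [← e, add_right_comm, sin_int_mul_theta_add, sin_int_mul_theta_add, mul_mul_mul_comm,
      neg_one_zpow_mul_self, one_mul]
    exact mul_nonneg (sin_int_mul_theta_nonneg n (by omega) (by omega))
      (sin_int_mul_theta_nonneg n (by omega) (by omega))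
  linarith

/-- Among the even multiples of `theta n` other than `0` and `±2 * theta n`, the largest cosine is
that of `4 * theta n`. -/
theorem cos_even_mul_theta_le (m : ℤ) (h0 : ¬ (n : ℤ) ∣ m) (h1 : ¬ (n : ℤ) ∣ m - 1)
    (h2 : ¬ (n : ℤ) ∣ m + 1) : Real.cos (2 * m * theta n) ≤ Real.cos (4 * theta n) := by
  have key : Real.cos (4 * theta n) - Real.cos (2 * m * theta n) =
      2 * (Real.sin (((m + 2 : ℤ) : ℝ) * theta n) * Real.sin (((m - 2 : ℤ) : ℝ) * theta n)) := by
    rw [Real.cos_sub_cos,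
      show (4 * theta n + 2 * m * theta n) / 2 = ((m + 2 : ℤ) : ℝ) * theta n by push_cast; ring,
      show (4 * theta n - 2 * m * theta n) / 2 = -(((m - 2 : ℤ) : ℝ) * theta n) by push_cast; ring,
      Real.sin_neg]
    ring
  have hpos : (0 : ℤ) < n := by exact_mod_cast lt_of_lt_of_le (by norm_num) hn.out
  have e := Int.emod_add_mul_ediv m n
  set r := m % n with hr
  have hr0 := Int.emod_nonneg m hpos.ne'
  have hrn := Int.emod_lt_of_pos m hpos
  have r0 : r ≠ 0 := fun h => h0 (Int.dvd_of_emod_eq_zero h)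
  have r1 : r ≠ 1 := fun h => h1 ⟨m / n, by linarith⟩
  have r2 : r ≠ n - 1 := fun h => h2 ⟨m / n + 1, by linarith⟩
  have : 0 ≤ Real.sin (((m + 2 : ℤ) : ℝ) * theta n) * Real.sin (((m - 2 : ℤ) : ℝ) * theta n) := by
    rw [← e, add_right_comm, add_sub_right_comm, sin_int_mul_theta_add, sin_int_mul_theta_add,
      mul_mul_mul_comm, neg_one_zpow_mul_self, one_mul]
    exact mul_nonneg (sin_int_mul_theta_nonneg n (by omega) (by omega))
      (sin_int_mul_theta_nonneg n (by omega) (by omega))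
  linarith

/-! The normals and vertices -/

/-- The outward normal of the plane containing the polygon. -/
def faceNormal : Normal := ⟨![0, 0, 0, 1], by simp [lor]⟩

/-- The outward normals of the sides of the polygon. -/
def sideNormal (k : ℤ) : Normal :=
  ⟨![normA n, normB n * Real.cos (2 * k * theta n), normB n * Real.sin (2 * k * theta n), 0], by
    simp only [lor, Matrix.cons_val]
    nlinarith [Real.sin_sq_add_cos_sq (2 * k * theta n), normA_sq n]⟩

/-- The vertices of the polygon. -/
def vertex (k : ℤ) : H3 :=
  ⟨![√2 * (normB n * Real.cos (theta n)), √2 * (normA n * Real.cos ((2 * k + 1) * theta n)),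
      √2 * (normA n * Real.sin ((2 * k + 1) * theta n)), 0], by
    have h2 : √2 ^ 2 = (2 : ℝ) := Real.sq_sqrt (by norm_num)
    have h3 := Real.sin_sq_add_cos_sq ((2 * k + 1) * theta n)
    have h4 := Real.sin_sq_add_cos_sq (theta n)
    have hA := normA_sq n
    have hB := normB_sq_mul n
    constructor
    · simp only [lor, Matrix.cons_val]
      generalize Real.sin ((2 * k + 1) * theta n) = s at *
      generalize Real.cos ((2 * k + 1) * theta n) = c at *
      linear_combination (-(normB n * Real.cos (theta n)) ^ 2 + (normA n * c) ^ 2 +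
        (normA n * s) ^ 2) * h2 + 2 * normA n ^ 2 * h3 + 2 * hA + hB - 2 * normB n ^ 2 * h4
    · have := normB_pos n
      have := cos_theta_pos n
      simp only [Matrix.cons_val]
      positivity⟩

theorem lor_faceNormal (x : Fin 4 → ℝ) : lor x faceNormal.1 = x 3 := by
  simp [lor, faceNormal]

theorem sideNormal_add_mul (k q : ℤ) : sideNormal n (k + n * q) = sideNormal n k := by
  have e : 2 * ((k + n * q : ℤ) : ℝ) * theta n = 2 * k * theta n + q * (2 * Real.pi) := by
    rw [← mul_theta n]; push_cast; ring
  ext1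
  simp only [sideNormal]
  rw [e, Real.cos_add_int_mul_two_pi, Real.sin_add_int_mul_two_pi]

theorem vertex_add_mul (k q : ℤ) : vertex n (k + n * q) = vertex n k := by
  have e : (2 * ((k + n * q : ℤ) : ℝ) + 1) * theta n =
      (2 * k + 1) * theta n + q * (2 * Real.pi) := by
    rw [← mul_theta n]; push_cast; ring
  ext1
  simp only [vertex]
  rw [e, Real.cos_add_int_mul_two_pi, Real.sin_add_int_mul_two_pi]

theorem sideNormal_emod (k : ℤ) : sideNormal n (k % n) = sideNormal n k := by
  conv_rhs => rw [← Int.emod_add_mul_ediv k n, sideNormal_add_mul]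

theorem vertex_emod (k : ℤ) : vertex n (k % n) = vertex n k := by
  conv_rhs => rw [← Int.emod_add_mul_ediv k n, vertex_add_mul]

theorem lor_vertex_vertex (j k : ℤ) : lor (vertex n j).1 (vertex n k).1 =
    -(2 * normB n ^ 2 - 1) + 2 * normA n ^ 2 * Real.cos (2 * (j - k) * theta n) := by
  have h2 : √2 ^ 2 = (2 : ℝ) := Real.sq_sqrt (by norm_num)
  have h4 := Real.sin_sq_add_cos_sq (theta n)
  have hB := normB_sq_mul n
  have e : 2 * ((j : ℝ) - k) * theta n = (2 * j + 1) * theta n - (2 * k + 1) * theta n := by ring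
  rw [e, Real.cos_sub]
  simp only [lor, vertex, Matrix.cons_val]
  generalize Real.sin ((2 * k + 1) * theta n) = s at *
  generalize Real.cos ((2 * k + 1) * theta n) = c at *
  generalize Real.sin ((2 * j + 1) * theta n) = s' at *
  generalize Real.cos ((2 * j + 1) * theta n) = c' at *
  linear_combination (-(normB n * Real.cos (theta n)) ^ 2 + normA n ^ 2 * c * c' +
    normA n ^ 2 * s * s') * h2 + hB - 2 * normB n ^ 2 * h4

theorem lor_vertex_sideNormal (j k : ℤ) : lor (vertex n j).1 (sideNormal n k).1 =
    √2 * normA n * normB n *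
      (Real.cos ((2 * (j - k : ℤ) + 1) * theta n) - Real.cos (theta n)) := by
  have e : (2 * ((j - k : ℤ) : ℝ) + 1) * theta n = (2 * j + 1) * theta n - 2 * k * theta n := by
    push_cast; ring
  rw [e, Real.cos_sub]
  simp only [lor, vertex, sideNormal, Matrix.cons_val]
  ring

theorem vertex_mem_sideNormal (k : ℤ) : vertex n k ∈ plane (sideNormal n k) := by
  change lor _ _ = 0
  rw [lor_vertex_sideNormal]
  simp

theorem vertex_mem_sideNormal_succ (k : ℤ) : vertex n k ∈ plane (sideNormal n (k + 1)) := by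
  change lor _ _ = 0
  rw [lor_vertex_sideNormal, show (2 * ((k - (k + 1) : ℤ) : ℝ) + 1) * theta n = -theta n by
    push_cast; ring]
  simp

theorem dvd_sub_of_vertex_eq {j k : ℤ} (h : vertex n j = vertex n k) : (n : ℤ) ∣ j - k := by
  have h1 : lor (vertex n j).1 (vertex n k).1 = -1 := by rw [h]; exact (vertex n k).2.1
  rw [lor_vertex_vertex] at h1
  have hA := normA_sq n
  have hpos := normA_pos n
  have hc : Real.cos (2 * (j - k) * theta n) = 1 := by
    have : 2 * normA n ^ 2 * (Real.cos (2 * (j - k) * theta n) - 1) = 0 := by linarith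
    have := (mul_eq_zero.1 this).resolve_left (by positivity)
    linarith
  apply sin_int_mul_theta_eq_zero n
  rw [mul_assoc, Real.cos_two_mul] at hc
  have := Real.sin_sq_add_cos_sq ((j - k) * theta n)
  push_cast
  nlinarith

/-! ### The polygon as an intersection of half-planes and as a convex hull -/

/-- The regular right-angled polygon with vertices `vertex n k`, described by its sides. -/
def polygon : Set H3 := {x | x ∈ plane faceNormal ∧ ∀ k, x ∈ halfSpace (sideNormal n k)}

theorem isConvex_polygon : IsConvex (polygon n) := fun x hx y hy _ hz =>
  ⟨isConvex_plane _ x hx.1 y hy.1 hz, fun k => isConvex_halfSpace _ x (hx.2 k) y (hy.2 k) hz⟩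

theorem vertex_mem_polygon (k : ℤ) : vertex n k ∈ polygon n := by
  refine ⟨by change lor _ _ = 0; rw [lor_faceNormal]; simp [vertex], fun j => ?_⟩
  change lor _ _ ≤ 0
  rw [lor_vertex_sideNormal]
  have := normA_pos n
  have := normB_pos n
  exact mul_nonpos_of_nonneg_of_nonpos (by positivity)
    (by linarith [cos_odd_mul_theta_le n (k - j)])

/-- A point of the plane of the polygon in terms of the end points of a side and the centre. -/
theorem eq_smul_vertex_add (x : Fin 4 → ℝ) (hx : x 3 = 0) (k : ℤ) :
    ∃ c : ℝ, 0 < c ∧ x =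
      (c * (lor x (sideNormal n (k + 1)).1 - lor x (sideNormal n (k + 1 + 1)).1)) •
        (vertex n k).1 +
      (c * (lor x (sideNormal n (k + 1)).1 - lor x (sideNormal n k).1)) •
        (vertex n (k + 1)).1 +
      (-lor x (sideNormal n (k + 1)).1 / normA n) • ![1, 0, 0, 0] := by
  have hA := normA_pos n
  have hB := normB_pos n
  have hs := sin_theta_pos n
  have hc := cos_theta_pos n
  have hsc := Real.sin_sq_add_cos_sq (theta n)
  set φ : ℝ := 2 * (k + 1) * theta n with hφ
  have hsc' := Real.sin_sq_add_cos_sq φ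
  have h2 : √2 ^ 2 = (2 : ℝ) := Real.sq_sqrt (by norm_num)
  have e0 : 2 * (k : ℝ) * theta n = φ - 2 * theta n := by rw [hφ]; ring
  have e1 : 2 * ((k + 1 : ℤ) : ℝ) * theta n = φ := by rw [hφ]; push_cast; ring
  have e2 : 2 * ((k + 1 + 1 : ℤ) : ℝ) * theta n = φ + 2 * theta n := by rw [hφ]; push_cast; ring
  have f0 : (2 * (k : ℝ) + 1) * theta n = φ - theta n := by rw [hφ]; ring
  have f1 : (2 * ((k + 1 : ℤ) : ℝ) + 1) * theta n = φ + theta n := by rw [hφ]; push_cast; ring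
  have hd1 : lor x (sideNormal n (k + 1)).1 - lor x (sideNormal n (k + 1 + 1)).1 =
      2 * normB n * Real.sin (theta n) *
        (x 1 * Real.sin (φ + theta n) - x 2 * Real.cos (φ + theta n)) := by
    simp only [lor, sideNormal, Matrix.cons_val, e1, e2, Real.sin_add, Real.cos_add,
      Real.sin_two_mul, Real.cos_two_mul']
    linear_combination (normB n * x 1 * Real.cos φ + normB n * x 2 * Real.sin φ) * hsc * (-1)
  have hd2 : lor x (sideNormal n (k + 1)).1 - lor x (sideNormal n k).1 =
      2 * normB n * Real.sin (theta n) *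
        (x 2 * Real.cos (φ - theta n) - x 1 * Real.sin (φ - theta n)) := by
    simp only [lor, sideNormal, Matrix.cons_val, e1, e0, Real.sin_sub, Real.cos_sub,
      Real.sin_two_mul, Real.cos_two_mul']
    linear_combination (normB n * x 1 * Real.cos φ + normB n * x 2 * Real.sin φ) * hsc * (-1)
  have hd3 : lor x (sideNormal n (k + 1)).1 =
      -(x 0 * normA n) + normB n * (x 1 * Real.cos φ + x 2 * Real.sin φ) := by
    simp only [lor, sideNormal, Matrix.cons_val, e1]
    ring
  -- The three factors are the radius of the vertices, the scale of the differences in `hd1` and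
  -- `hd2`, and `sin (2 * theta n)`, the determinant of the two vertex directions.
  refine ⟨(√2 * normA n * (2 * normB n * Real.sin (theta n)) *
    (2 * Real.sin (theta n) * Real.cos (theta n)))⁻¹, by positivity, ?_⟩
  rw [hd1, hd2, hd3]
  simp only [vertex, f0, f1]
  set a := x 1 * Real.sin (φ + theta n) - x 2 * Real.cos (φ + theta n) with ha
  set b := x 2 * Real.cos (φ - theta n) - x 1 * Real.sin (φ - theta n) with hb
  have hab1 : a * Real.cos (φ - theta n) + b * Real.cos (φ + theta n) =
      2 * Real.sin (theta n) * Real.cos (theta n) * x 1 := by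
    rw [ha, hb]
    simp only [Real.sin_sub, Real.cos_sub, Real.sin_add, Real.cos_add]
    linear_combination 2 * x 1 * Real.sin (theta n) * Real.cos (theta n) * hsc'
  have hab2 : a * Real.sin (φ - theta n) + b * Real.sin (φ + theta n) =
      2 * Real.sin (theta n) * Real.cos (theta n) * x 2 := by
    rw [ha, hb]
    simp only [Real.sin_sub, Real.cos_sub, Real.sin_add, Real.cos_add]
    linear_combination 2 * x 2 * Real.sin (theta n) * Real.cos (theta n) * hsc'
  have hab3 : a + b = 2 * Real.sin (theta n) * (x 1 * Real.cos φ + x 2 * Real.sin φ) := by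
    rw [ha, hb]
    simp only [Real.sin_sub, Real.cos_sub, Real.sin_add, Real.cos_add]
    ring
  clear_value a b
  ext i
  fin_cases i
  · simp
    field_simp
    linear_combination (-normB n) * hab3
  · simp
    field_simp
    linear_combination -hab1
  · simp
    field_simp
    linear_combination -hab2
  · simpa using hx

/-- This puts the centre into the hull of the vertices. The sums of cosines and sines telescope
after multiplication by `2 * sin (theta n)`. -/
theorem sum_vertex : ∑ k ∈ Finset.range n, (vertex n k).1 =
    (n * (√2 * (normB n * Real.cos (theta n)))) • ![1, 0, 0, 0] := by
  have hs := sin_theta_pos n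
  have hcos : ∑ k ∈ Finset.range n, Real.cos ((2 * k + 1) * theta n) = 0 := by
    have h : ∀ k : ℕ, 2 * Real.sin (theta n) * Real.cos ((2 * k + 1) * theta n) =
        Real.sin (2 * ((k + 1 : ℕ) : ℝ) * theta n) - Real.sin (2 * (k : ℝ) * theta n) := by
      intro k
      rw [show 2 * ((k + 1 : ℕ) : ℝ) * theta n = (2 * k + 1) * theta n + theta n by
          push_cast; ring,
        show 2 * (k : ℝ) * theta n = (2 * k + 1) * theta n - theta n by ring,
        Real.sin_add, Real.sin_sub]
      ring
    have h' : 2 * Real.sin (theta n) * ∑ k ∈ Finset.range n, Real.cos ((2 * k + 1) * theta n) =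
        0 := by
      rw [Finset.mul_sum, Finset.sum_congr rfl fun k _ => h k,
        Finset.sum_range_sub fun k : ℕ => Real.sin (2 * (k : ℝ) * theta n), mul_assoc, mul_theta]
      simp
    exact (mul_eq_zero.1 h').resolve_left (by positivity)
  have hsin : ∑ k ∈ Finset.range n, Real.sin ((2 * k + 1) * theta n) = 0 := by
    have h : ∀ k : ℕ, 2 * Real.sin (theta n) * Real.sin ((2 * k + 1) * theta n) =
        -Real.cos (2 * ((k + 1 : ℕ) : ℝ) * theta n) - -Real.cos (2 * (k : ℝ) * theta n) := by
      intro k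
      rw [show 2 * ((k + 1 : ℕ) : ℝ) * theta n = (2 * k + 1) * theta n + theta n by
          push_cast; ring,
        show 2 * (k : ℝ) * theta n = (2 * k + 1) * theta n - theta n by ring,
        Real.cos_add, Real.cos_sub]
      ring
    have h' : 2 * Real.sin (theta n) * ∑ k ∈ Finset.range n, Real.sin ((2 * k + 1) * theta n) =
        0 := by
      rw [Finset.mul_sum, Finset.sum_congr rfl fun k _ => h k,
        Finset.sum_range_sub fun k : ℕ => -Real.cos (2 * (k : ℝ) * theta n), mul_assoc, mul_theta]
      simp
    exact (mul_eq_zero.1 h').resolve_left (by positivity)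
  ext i
  rw [Finset.sum_apply]
  fin_cases i
  · simp [vertex]
  · simp [vertex, ← Finset.mul_sum, hcos]
  · simp [vertex, ← Finset.mul_sum, hsin]
  · simp [vertex]

theorem polygon_eq_hull : polygon n = hull (Set.range (vertex n)) := by
  apply Set.Subset.antisymm
  · intro x hx
    have hx3 : x.1 3 = 0 := (lor_faceNormal x.1).symm.trans hx.1
    have hK := isConvex_hull (Set.range (vertex n))
    have hv : ∀ k, (vertex n k).1 ∈ cone (hull (Set.range (vertex n))) := fun k =>
      mem_cone_of_mem (subset_hull _ ⟨k, rfl⟩)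
    have hpos : 0 < n := lt_of_lt_of_le (by norm_num) hn.out
    have hP : 0 < (n : ℝ) * (√2 * (normB n * Real.cos (theta n))) := by
      have := natCast_pos n
      have := normB_pos n
      have := cos_theta_pos n
      positivity
    have he : (![1, 0, 0, 0] : Fin 4 → ℝ) ∈ cone (hull (Set.range (vertex n))) := by
      have h1 := smul_mem_cone (hK.sum_mem_cone (s := Finset.range n)
        (f := fun k => (vertex n k).1) ⟨0, Finset.mem_range.2 hpos⟩ fun k _ => hv k)
        (inv_pos.2 hP)
      rwa [sum_vertex, smul_smul, inv_mul_cancel₀ hP.ne', one_smul] at h1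
    -- The side with the largest product selects the sector, seen from the centre, that contains
    -- `x`. Maximality and `x ∈ polygon n` make the three coefficients of `eq_smul_vertex_add`
    -- nonnegative; the shift to `j - 1` is due to side `j` joining vertices `j - 1` and `j`.
    obtain ⟨j, -, hj⟩ := Finset.exists_max_image (Finset.range n)
      (fun k : ℕ => lor x.1 (sideNormal n k).1) ⟨0, Finset.mem_range.2 hpos⟩
    have hmax : ∀ k : ℤ, lor x.1 (sideNormal n k).1 ≤ lor x.1 (sideNormal n j).1 := by
      intro k
      have hpos' : (0 : ℤ) < n := by exact_mod_cast hpos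
      obtain ⟨r, hr⟩ := Int.eq_ofNat_of_zero_le (Int.emod_nonneg k hpos'.ne')
      have hrn : r < n := by
        have := Int.emod_lt_of_pos k hpos'
        omega
      have := hj r (Finset.mem_range.2 hrn)
      rwa [← hr, sideNormal_emod] at this
    obtain ⟨c, hc, e⟩ := eq_smul_vertex_add n x.1 hx3 (j - 1)
    have h1 := hmax (j - 1)
    have h2 := hmax (j - 1 + 1 + 1)
    have h3 : lor x.1 (sideNormal n j).1 ≤ 0 := hx.2 j
    have hmem := hK.add_mem_insert_cone (hK.add_mem_insert_cone
      (smul_mem_insert_cone (hv (j - 1))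
        (r := c * (lor x.1 (sideNormal n (j - 1 + 1)).1 - lor x.1 (sideNormal n (j - 1 + 1 + 1)).1))
        (by rw [sub_add_cancel] at *; exact mul_nonneg hc.le (by linarith)))
      (smul_mem_insert_cone (hv (j - 1 + 1))
        (r := c * (lor x.1 (sideNormal n (j - 1 + 1)).1 - lor x.1 (sideNormal n (j - 1)).1))
        (by rw [sub_add_cancel] at *; exact mul_nonneg hc.le (by linarith))))
      (smul_mem_insert_cone he (r := -lor x.1 (sideNormal n (j - 1 + 1)).1 / normA n)
        (by
          rw [sub_add_cancel] at *
          exact div_nonneg (by linarith) (normA_pos n).le))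
    rw [← e] at hmem
    rcases hmem with h0 | h
    · have := x.2.2
      simp [h0] at this
    · exact mem_of_mem_cone h
  · apply hull_subset (isConvex_polygon n)
    rintro _ ⟨k, rfl⟩
    exact vertex_mem_polygon n k

theorem vertex_ne_succ (k : ℤ) : vertex n k ≠ vertex n (k + 1) := by
  intro h
  have h1 := dvd_sub_of_vertex_eq n h
  rw [show k - (k + 1) = -1 by ring, Int.dvd_neg] at h1
  have := Int.le_of_dvd one_pos h1
  have := hn.out
  omega

theorem polygon_inter_plane (k : ℤ) :
    polygon n ∩ plane (sideNormal n (k + 1)) = segment (vertex n k) (vertex n (k + 1)) := by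
  apply Set.Subset.antisymm
  · rintro x ⟨hx, hxk⟩
    have hx3 : x.1 3 = 0 := (lor_faceNormal x.1).symm.trans hx.1
    have hxk : lor x.1 (sideNormal n (k + 1)).1 = 0 := hxk
    obtain ⟨c, hc, e⟩ := eq_smul_vertex_add n x.1 hx3 k
    have h1 : lor x.1 (sideNormal n k).1 ≤ 0 := hx.2 k
    have h2 : lor x.1 (sideNormal n (k + 1 + 1)).1 ≤ 0 := hx.2 (k + 1 + 1)
    rw [hxk, neg_zero, zero_div, zero_smul, add_zero] at e
    exact ⟨_, _, mul_nonneg hc.le (by linarith), mul_nonneg hc.le (by linarith), e⟩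
  · intro x hx
    exact (isConvex_polygon n).inter (isConvex_plane _) _
      ⟨vertex_mem_polygon n k, vertex_mem_sideNormal_succ n k⟩ _
      ⟨vertex_mem_polygon n (k + 1), vertex_mem_sideNormal n (k + 1)⟩ hx

theorem isFace_segment (k : ℤ) :
    IsFace 1 (polygon n) (segment (vertex n k) (vertex n (k + 1))) :=
  ⟨sideNormal n (k + 1), fun _ hx => hx.2 _, (polygon_inter_plane n k).symm,
    finrank_span_segment (vertex_ne_succ n k)⟩

theorem lor_toward (x p y : H3) :
    lor (toward p x) (toward p y) = lor x.1 y.1 + lor x.1 p.1 * lor p.1 y.1 := by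
  simp [toward, p.2.1, lor_comm y.1 p.1]

theorem angle_vertex (k : ℤ) :
    angle (vertex n (k - 1)) (vertex n k) (vertex n (k + 1)) = Real.pi / 2 := by
  have h : lor (toward (vertex n k) (vertex n (k - 1))) (toward (vertex n k) (vertex n (k + 1))) =
      0 := by
    rw [lor_toward, lor_vertex_vertex, lor_vertex_vertex, lor_vertex_vertex]
    push_cast
    rw [show 2 * ((k : ℝ) - 1 - (k + 1)) * theta n = -(2 * (2 * theta n)) by ring,
      show 2 * ((k : ℝ) - 1 - k) * theta n = -(2 * theta n) by ring,
      show 2 * ((k : ℝ) - (k + 1)) * theta n = -(2 * theta n) by ring, Real.cos_neg, Real.cos_neg,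
      Real.cos_two_mul, Real.cos_two_mul, normA_sq]
    have h4 := Real.sin_sq_add_cos_sq (theta n)
    have hB := normB_sq_mul n
    have hc : 2 * normB n ^ 2 * Real.cos (theta n) ^ 2 = 2 * normB n ^ 2 - 1 := by
      linear_combination 2 * normB n ^ 2 * h4 - hB
    linear_combination (4 - 8 * Real.cos (theta n) ^ 2 +
      4 * (2 * normB n ^ 2 * Real.cos (theta n) ^ 2 - 2 * normB n ^ 2 + 1)) * hc
  rw [angle, h, zero_div, Real.arccos_zero]

/-- The vertices, indexed cyclically. -/
def cyclicVertex (i : ZMod n) : H3 := vertex n i.val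

theorem cyclicVertex_intCast (k : ℤ) : cyclicVertex n (k : ZMod n) = vertex n k := by
  have : NeZero n := ⟨by have := hn.out; omega⟩
  rw [cyclicVertex, ZMod.val_intCast, vertex_emod]

theorem range_cyclicVertex : Set.range (cyclicVertex n) = Set.range (vertex n) := by
  ext x
  constructor
  · rintro ⟨i, rfl⟩
    exact ⟨_, rfl⟩
  · rintro ⟨k, rfl⟩
    exact ⟨_, cyclicVertex_intCast n k⟩

theorem isRegularRightAngledPolygon_polygon : IsRegularRightAngledPolygon n (polygon n) := by
  refine ⟨⟨faceNormal, fun x hx => hx.1⟩, cyclicVertex n, ?_, ?_, ?_,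
    ⟨hdist (vertex n 0) (vertex n 1), ?_⟩, ?_⟩
  · intro i j hij
    obtain ⟨i, rfl⟩ := ZMod.intCast_surjective i
    obtain ⟨j, rfl⟩ := ZMod.intCast_surjective j
    rw [cyclicVertex_intCast, cyclicVertex_intCast] at hij
    have := dvd_sub_of_vertex_eq n hij.symm
    exact (ZMod.intCast_eq_intCast_iff_dvd_sub i j n).2 this
  · rw [range_cyclicVertex]
    exact polygon_eq_hull n
  · intro i
    obtain ⟨k, rfl⟩ := ZMod.intCast_surjective i
    have e : (k : ZMod n) + 1 = ((k + 1 : ℤ) : ZMod n) := by push_cast; rfl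
    rw [e, cyclicVertex_intCast, cyclicVertex_intCast]
    exact isFace_segment n k
  · intro i
    obtain ⟨k, rfl⟩ := ZMod.intCast_surjective i
    have e : (k : ZMod n) + 1 = ((k + 1 : ℤ) : ZMod n) := by push_cast; rfl
    rw [e, cyclicVertex_intCast, cyclicVertex_intCast, hdist, hdist, lor_vertex_vertex,
      lor_vertex_vertex]
    push_cast
    congr 6
    ring
  · intro i
    obtain ⟨k, rfl⟩ := ZMod.intCast_surjective i
    have e : (k : ZMod n) + 1 = ((k + 1 : ℤ) : ZMod n) := by push_cast; rfl
    have e' : (k : ZMod n) - 1 = ((k - 1 : ℤ) : ZMod n) := by push_cast; rfl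
    rw [e, e', cyclicVertex_intCast, cyclicVertex_intCast, cyclicVertex_intCast]
    exact angle_vertex n k

end Polygon

/-! ### The reflection group of the tiling -/

/-- The reflection in the plane with unit normal `u`. -/
def reflect (u : Normal) : Module.End ℝ (Fin 4 → ℝ) :=
  LinearMap.id - (2 • lorForm u.1).smulRight u.1

theorem reflect_apply (u : Normal) (x : Fin 4 → ℝ) :
    reflect u x = x - (2 * lor x u.1) • u.1 := by
  simp [reflect, lorForm_apply, lor_comm u.1 x]

theorem reflect_of_orthogonal {u : Normal} {x : Fin 4 → ℝ} (h : lor x u.1 = 0) :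
    reflect u x = x := by
  rw [reflect_apply, h, mul_zero, zero_smul, sub_zero]

theorem lor_reflect (u : Normal) (x y : Fin 4 → ℝ) :
    lor (reflect u x) (reflect u y) = lor x y := by
  simp only [reflect_apply, lor_sub_left, lor_sub_right, lor_smul_left, lor_smul_right, u.2,
    lor_comm u.1 y]
  ring

theorem reflect_pos (u : Normal) (x : H3) : 0 < reflect u x.1 0 := by
  apply pos_zero_of_lor_neg x
  · rw [lor_reflect, x.2.1]
    norm_num
  · rw [reflect_apply]
    simp only [lor_sub_left, lor_smul_left, x.2.1, lor_comm u.1 x.1]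
    nlinarith [sq_nonneg (lor x.1 u.1)]

theorem reflect_mul_self (u : Normal) : reflect u * reflect u = 1 := by
  refine LinearMap.ext fun x => ?_
  simp only [Module.End.mul_apply, reflect_apply, lor_sub_left, lor_smul_left, u.2,
    Module.End.one_apply]
  module

theorem reflect_mul_reflect_sq {u v : Normal} (h : lor u.1 v.1 = 0) :
    (reflect u * reflect v) ^ 2 = 1 := by
  have hcomm : reflect u * reflect v = reflect v * reflect u := by
    refine LinearMap.ext fun x => ?_
    simp only [Module.End.mul_apply, reflect_apply, lor_sub_left, lor_smul_left, h,
      lor_comm v.1 u.1]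
    module
  rw [sq]
  nth_rewrite 1 [hcomm]
  rw [mul_assoc, ← mul_assoc (reflect u), reflect_mul_self, one_mul, reflect_mul_self]

theorem reflect_mul_reflect_cube {u v : Normal} (h : lor u.1 v.1 = -(1 / 2)) :
    (reflect u * reflect v) ^ 3 = 1 := by
  -- Both sides are the reflection in `u + v`, which is a unit vector here.
  have hbraid : reflect u * reflect v * reflect u = reflect v * reflect u * reflect v := by
    refine LinearMap.ext fun x => ?_
    simp only [Module.End.mul_apply, reflect_apply, lor_sub_left, lor_smul_left, h,
      lor_comm v.1 u.1, u.2, v.2]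
    module
  calc (reflect u * reflect v) ^ 3
      = (reflect u * reflect v * reflect u) * (reflect v * reflect u * reflect v) := by
        simp only [pow_succ, pow_zero, one_mul, mul_assoc]
    _ = (reflect v * reflect u * reflect v) * (reflect v * reflect u * reflect v) := by
        rw [hbraid]
    _ = reflect v * (reflect u * (reflect v * reflect v) * reflect u) * reflect v := by
        simp only [mul_assoc]
    _ = 1 := by
        rw [reflect_mul_self, mul_one, reflect_mul_self, mul_one, reflect_mul_self]

theorem reflect_mul_reflect_pow_comm {u v : Normal} {m : ℕ}
    (h : (reflect u * reflect v) ^ m = 1) : (reflect v * reflect u) ^ m = 1 := by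
  have h1 : (reflect u * reflect v) * (reflect v * reflect u) = 1 := by
    rw [mul_assoc, ← mul_assoc (reflect v), reflect_mul_self, one_mul, reflect_mul_self]
  have h2 : (reflect v * reflect u) * (reflect u * reflect v) = 1 := by
    rw [mul_assoc, ← mul_assoc (reflect u), reflect_mul_self, one_mul, reflect_mul_self]
  have hc : Commute (reflect u * reflect v) (reflect v * reflect u) := h1.trans h2.symm
  have := hc.mul_pow m
  rwa [h1, one_pow, h, one_mul, eq_comm] at this

/-! ### The triangle group and its action on hyperbolic space -/

section Tiling

variable (n : ℕ) [hn : Fact (6 ≤ n)]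

/-- The Coxeter matrix of the symmetry group of a tiling by `n`-gons, three at each vertex. -/
def tilingMatrix : CoxeterMatrix (Fin 3) where
  M := !![1, n, 2; n, 1, 3; 2, 3, 1]
  isSymm := by ext i j; fin_cases i <;> fin_cases j <;> rfl
  diagonal i := by fin_cases i <;> rfl
  off_diagonal i j h := by
    have := hn.out
    fin_cases i <;> fin_cases j <;> simp_all <;> omega

/-- The normals of the mirrors: the perpendicular bisector of a side, the bisector of an angle, and
the plane that exchanges two adjacent faces. -/
def mirror : Fin 3 → Normal :=
  ![⟨![0, 0, -1, 0], by simp [lor]⟩,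
    ⟨![0, -Real.sin (theta n), Real.cos (theta n), 0], by
      simp only [lor, Matrix.cons_val]
      nlinarith [Real.sin_sq_add_cos_sq (theta n)]⟩,
    ⟨(√2)⁻¹ • ![normA n, normB n, 0, -1], by
      have h2 : √2 ^ 2 = (2 : ℝ) := Real.sq_sqrt (by norm_num)
      have hs : (√2 : ℝ) ≠ 0 := by positivity
      have hA := normA_sq n
      rw [lor_smul_left, lor_smul_right]
      simp only [lor, Matrix.cons_val]
      field_simp
      linarith⟩]

theorem lor_mirror_zero (x : Fin 4 → ℝ) : lor x (mirror n 0).1 = -x 2 := by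
  simp [lor, mirror]

theorem lor_mirror_one (x : Fin 4 → ℝ) :
    lor x (mirror n 1).1 = -Real.sin (theta n) * x 1 + Real.cos (theta n) * x 2 := by
  simp [lor, mirror]
  ring

theorem lor_mirror_two (x : Fin 4 → ℝ) :
    lor x (mirror n 2).1 = (√2)⁻¹ * (-(normA n * x 0) + normB n * x 1 - x 3) := by
  simp [lor, mirror]
  ring

theorem reflect_mirror_zero (x : Fin 4 → ℝ) :
    reflect (mirror n 0) x = ![x 0, x 1, -x 2, x 3] := by
  rw [reflect_apply, lor_mirror_zero]
  ext i; fin_cases i <;> simp [mirror]; ring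

theorem reflect_mirror_one (x : Fin 4 → ℝ) :
    reflect (mirror n 1) x = ![x 0,
      Real.cos (2 * theta n) * x 1 + Real.sin (2 * theta n) * x 2,
      Real.sin (2 * theta n) * x 1 - Real.cos (2 * theta n) * x 2, x 3] := by
  have h := Real.sin_sq_add_cos_sq (theta n)
  rw [reflect_apply, lor_mirror_one]
  ext i; fin_cases i
  · simp [mirror]
  · simp [mirror, Real.sin_two_mul, Real.cos_two_mul']
    linear_combination (-x 1) * h
  · simp [mirror, Real.sin_two_mul, Real.cos_two_mul']
    linear_combination (-x 2) * h
  · simp [mirror]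

theorem reflect_mirror_two (x : Fin 4 → ℝ) : reflect (mirror n 2) x =
    x - (-(normA n * x 0) + normB n * x 1 - x 3) • ![normA n, normB n, 0, -1] := by
  have h2 : √2 ^ 2 = (2 : ℝ) := Real.sq_sqrt (by norm_num)
  have hs : 2 * ((√2)⁻¹ * (√2)⁻¹) = (1 : ℝ) := by field_simp; linarith
  rw [reflect_apply, lor_mirror_two]
  simp only [mirror, Matrix.cons_val, smul_smul]
  congr 2
  linear_combination (-(normA n * x 0) + normB n * x 1 - x 3) * hs

theorem rotation_pow (k : ℕ) (x : Fin 4 → ℝ) :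
    ((reflect (mirror n 0) * reflect (mirror n 1)) ^ k) x = ![x 0,
      Real.cos (2 * k * theta n) * x 1 + Real.sin (2 * k * theta n) * x 2,
      -Real.sin (2 * k * theta n) * x 1 + Real.cos (2 * k * theta n) * x 2, x 3] := by
  induction k with
  | zero => ext i; fin_cases i <;> simp
  | succ k ih =>
    rw [pow_succ', Module.End.mul_apply, ih, Module.End.mul_apply, reflect_mirror_one,
      reflect_mirror_zero]
    have e : 2 * ((k + 1 : ℕ) : ℝ) * theta n = 2 * theta n + 2 * k * theta n := by
      push_cast; ring
    rw [e, Real.cos_add, Real.sin_add]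
    ext i; fin_cases i <;> simp <;> ring

theorem rotation_pow_self : (reflect (mirror n 0) * reflect (mirror n 1)) ^ n = 1 := by
  refine LinearMap.ext fun x => ?_
  rw [rotation_pow, mul_assoc, mul_theta]
  ext i; fin_cases i <;> simp

/-- The mirror normals thus form a geometric root basis for `tilingMatrix`, as positivity of roots
requires. The entry `3` comes from the value of `normB`. -/
theorem lor_mirror_mirror {i j : Fin 3} (h : i ≠ j) : lor (mirror n i).1 (mirror n j).1 =
    -Real.cos (Real.pi / tilingMatrix n i j) := by
  have hB := normB_sq_mul n
  have hBp := normB_pos n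
  have hs := sin_theta_pos n
  have h01 : lor (mirror n 0).1 (mirror n 1).1 = -Real.cos (theta n) := by
    rw [lor_mirror_one]; simp [mirror]
  have h02 : lor (mirror n 0).1 (mirror n 2).1 = 0 := by
    rw [lor_mirror_two]; simp [mirror]
  have h12 : lor (mirror n 1).1 (mirror n 2).1 = -(1 / 2) := by
    have h2 : √2 ^ 2 = (2 : ℝ) := Real.sq_sqrt (by norm_num)
    rw [lor_mirror_two]
    simp [mirror, normB]
    field_simp
    linarith
  have m01 : (tilingMatrix n 0 1 : ℕ) = n := rfl
  have m10 : (tilingMatrix n 1 0 : ℕ) = n := rfl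
  have m02 : (tilingMatrix n 0 2 : ℕ) = 2 := rfl
  have m20 : (tilingMatrix n 2 0 : ℕ) = 2 := rfl
  have m12 : (tilingMatrix n 1 2 : ℕ) = 3 := rfl
  have m21 : (tilingMatrix n 2 1 : ℕ) = 3 := rfl
  fin_cases i <;> fin_cases j <;>
    simp only [Fin.zero_eta, Fin.mk_one, Fin.reduceFinMk, m01, m10, m02, m20, m12, m21] <;>
    first
      | exact absurd rfl h
      | (first | rw [h01] | rw [lor_comm, h01]); rfl
      | (first | rw [h02] | rw [lor_comm, h02]); norm_num
      | (first | rw [h12] | rw [lor_comm, h12]); norm_num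

theorem isLiftable_mirror : (tilingMatrix n).IsLiftable fun i => reflect (mirror n i) := by
  have h01 := rotation_pow_self n
  have h02 : (reflect (mirror n 0) * reflect (mirror n 2)) ^ 2 = 1 := by
    apply reflect_mul_reflect_sq
    rw [lor_mirror_two]; simp [mirror]
  have h12 : (reflect (mirror n 1) * reflect (mirror n 2)) ^ 3 = 1 := by
    apply reflect_mul_reflect_cube
    rw [lor_mirror_mirror n (by decide), show (tilingMatrix n 1 2 : ℕ) = 3 from rfl]
    norm_num
  intro i j
  rcases eq_or_ne i j with rfl | hij
  · rw [(tilingMatrix n).diagonal, pow_one, reflect_mul_self]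
  · fin_cases i <;> fin_cases j <;> first
      | exact absurd rfl hij
      | exact h01
      | exact h02
      | exact h12
      | exact reflect_mul_reflect_pow_comm h01
      | exact reflect_mul_reflect_pow_comm h02
      | exact reflect_mul_reflect_pow_comm h12

/-- The symmetry group of the tiling. -/
abbrev TilingGroup : Type := (tilingMatrix n).Group

/-- The Coxeter system of the tiling. -/
abbrev tilingSystem : CoxeterSystem (tilingMatrix n) (TilingGroup n) :=
  (tilingMatrix n).toCoxeterSystem

/-- The action of the symmetry group of the tiling on the ambient space. -/
def tilingRep : TilingGroup n →* Module.End ℝ (Fin 4 → ℝ) :=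
  (tilingSystem n).lift ⟨_, isLiftable_mirror n⟩

theorem tilingRep_simple (i : Fin 3) :
    tilingRep n ((tilingSystem n).simple i) = reflect (mirror n i) :=
  (tilingSystem n).lift_apply_simple (isLiftable_mirror n) i

theorem lor_tilingRep (w : TilingGroup n) (x y : Fin 4 → ℝ) :
    lor (tilingRep n w x) (tilingRep n w y) = lor x y := by
  induction w using (tilingSystem n).simple_induction_left with
  | one => simp
  | mul_simple_left w i ih =>
    rw [map_mul, tilingRep_simple, Module.End.mul_apply, Module.End.mul_apply, lor_reflect, ih]

theorem tilingRep_pos (w : TilingGroup n) (x : H3) : 0 < tilingRep n w x.1 0 := by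
  induction w using (tilingSystem n).simple_induction_left with
  | one => simpa using x.2.2
  | mul_simple_left w i ih =>
    rw [map_mul, tilingRep_simple, Module.End.mul_apply]
    exact reflect_pos _ ⟨tilingRep n w x.1, (lor_tilingRep n w _ _).trans x.2.1, ih⟩

theorem tilingRep_inv_apply (w : TilingGroup n) (x : Fin 4 → ℝ) :
    tilingRep n w⁻¹ (tilingRep n w x) = x := by
  rw [← Module.End.mul_apply, ← map_mul, inv_mul_cancel, map_one, Module.End.one_apply]

theorem tilingRep_apply_inv (w : TilingGroup n) (x : Fin 4 → ℝ) :
    tilingRep n w (tilingRep n w⁻¹ x) = x := by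
  rw [← Module.End.mul_apply, ← map_mul, mul_inv_cancel, map_one, Module.End.one_apply]

theorem lor_tilingRep_left (w : TilingGroup n) (x y : Fin 4 → ℝ) :
    lor (tilingRep n w x) y = lor x (tilingRep n w⁻¹ y) := by
  rw [← lor_tilingRep n w x, tilingRep_apply_inv]

/-- The action by isometries. -/
def tilingIsom (w : TilingGroup n) : Isom where
  lin := LinearEquiv.ofLinearMap (tilingRep n w) (tilingRep n w⁻¹)
    (LinearMap.ext (tilingRep_apply_inv n w)) (LinearMap.ext (tilingRep_inv_apply n w))
  map_lor := lor_tilingRep n w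
  map_pos := tilingRep_pos n w

theorem tilingIsom_nrm_val (w : TilingGroup n) (u : Normal) :
    ((tilingIsom n w).nrm u).1 = tilingRep n w u.1 := rfl

theorem tilingIsom_nrm_mul (w w' : TilingGroup n) (u : Normal) :
    (tilingIsom n (w * w')).nrm u = (tilingIsom n w).nrm ((tilingIsom n w').nrm u) := by
  ext1
  simp only [tilingIsom_nrm_val, map_mul, Module.End.mul_apply]

theorem tilingIsom_nrm_inv (w : TilingGroup n) (u : Normal) :
    (tilingIsom n w⁻¹).nrm ((tilingIsom n w).nrm u) = u :=
  Subtype.ext (tilingRep_inv_apply n w u.1)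

theorem tilingIsom_nrm_of_inv (w : TilingGroup n) (u : Normal) :
    (tilingIsom n w).nrm ((tilingIsom n w⁻¹).nrm u) = u :=
  Subtype.ext (tilingRep_apply_inv n w u.1)

/-! ### The orbit of the face normal -/

/-- Moving `w` to the other side turns the product into a linear form at a root. The form is the
product with `faceNormal`, which is nonpositive on simple roots: two mirrors are orthogonal to the
base plane and the third is tilted away. -/
theorem lor_mirror_nonpos {w : TilingGroup n} {i : Fin 3}
    (h : ¬ (tilingSystem n).IsLeftDescent w i) :
    lor (tilingRep n w faceNormal.1) (mirror n i).1 ≤ 0 := by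
  rw [lor_tilingRep_left]
  refine (tilingSystem n).map_root_nonpos_of_not_isRightDescent (tilingRep n)
    (fun i => (mirror n i).1) ?_ ?_ ?_ (lorForm faceNormal.1) ?_ w⁻¹ i ?_
  · intro i j
    have : n ≠ 0 := by have := hn.out; omega
    fin_cases i <;> fin_cases j <;> simp [tilingMatrix, this]
  · intro i
    rw [tilingRep_simple, reflect_apply, (mirror n i).2]
    module
  · intro i j hij
    rw [tilingRep_simple, reflect_apply, lor_mirror_mirror n hij.symm,
      (tilingMatrix n).symmetric j i]
    module
  · intro i
    rw [lorForm_apply, lor_comm, lor_faceNormal]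
    fin_cases i <;> simp [mirror]
  · rwa [← (tilingSystem n).isLeftDescent_inv_iff, inv_inv]

theorem reflect_mirror_zero_sideNormal (k : ℤ) :
    reflect (mirror n 0) (sideNormal n k).1 = (sideNormal n (-k)).1 := by
  rw [reflect_mirror_zero]
  simp [sideNormal]

theorem reflect_mirror_one_sideNormal (k : ℤ) :
    reflect (mirror n 1) (sideNormal n k).1 = (sideNormal n (1 - k)).1 := by
  rw [reflect_mirror_one]
  have e : 2 * ((1 - k : ℤ) : ℝ) * theta n = 2 * theta n - 2 * k * theta n := by push_cast; ring
  simp only [sideNormal, e, Real.cos_sub, Real.sin_sub]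
  ext i; fin_cases i <;> simp <;> ring

theorem reflect_mirror_two_faceNormal :
    reflect (mirror n 2) faceNormal.1 = (sideNormal n 0).1 := by
  rw [reflect_mirror_two]
  ext i; fin_cases i <;> simp [faceNormal, sideNormal]

theorem reflect_mirror_two_sideNormal_zero :
    reflect (mirror n 2) (sideNormal n 0).1 = faceNormal.1 := by
  rw [← reflect_mirror_two_faceNormal, ← Module.End.mul_apply, reflect_mul_self,
    Module.End.one_apply]

theorem reflect_mirror_two_sideNormal_three (k : ℤ) :
    reflect (mirror n 2) (sideNormal n k).1 3 =
      1 - normB n ^ 2 * (1 - Real.cos (2 * k * theta n)) := by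
  rw [reflect_mirror_two]
  simp [sideNormal]
  linear_combination -normA_sq n

/-- The two sides adjacent to side `0` are orthogonal to both planes exchanged by the third mirror,
hence are fixed by it. -/
theorem reflect_mirror_two_sideNormal_of_cos {k : ℤ}
    (h : Real.cos (2 * k * theta n) = Real.cos (2 * theta n)) :
    reflect (mirror n 2) (sideNormal n k).1 = (sideNormal n k).1 := by
  apply reflect_of_orthogonal
  rw [lor_mirror_two]
  simp only [sideNormal, Matrix.cons_val, h, Real.cos_two_mul]
  have h4 := Real.sin_sq_add_cos_sq (theta n)
  have hB := normB_sq_mul n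
  have hA := normA_sq n
  have : -(normA n * normA n) + normB n * (normB n * (2 * Real.cos (theta n) ^ 2 - 1)) - 0 = 0 := by
    linear_combination -hA + 2 * normB n ^ 2 * h4 - hB
  rw [this, mul_zero]

/-- Every face normal is that of the base face, that of one of its neighbours, or that of a face
whose plane does not cross the base plane. -/
theorem orbit_cases (w : TilingGroup n) :
    tilingRep n w faceNormal.1 = faceNormal.1 ∨
      (∃ k, tilingRep n w faceNormal.1 = (sideNormal n k).1) ∨
      tilingRep n w faceNormal.1 3 ≤ -1 := by
  induction hl : (tilingSystem n).length w using Nat.strong_induction_on generalizing w with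
  | _ l ih =>
    subst hl
    by_cases hw : w = 1
    · left; simp [hw]
    obtain ⟨i, hi⟩ := (tilingSystem n).exists_leftDescent_of_ne_one hw
    have hnot := (tilingSystem n).isLeftDescent_iff_not_isLeftDescent_mul.1 hi
    have hw' : w = (tilingSystem n).simple i * ((tilingSystem n).simple i * w) :=
      ((tilingSystem n).simple_mul_simple_cancel_left i).symm
    have hlt : (tilingSystem n).length ((tilingSystem n).simple i * w) <
        (tilingSystem n).length w := hi
    have IH := ih _ hlt _ rfl
    have hsign := lor_mirror_nonpos n hnot
    have he : tilingRep n w faceNormal.1 = reflect (mirror n i)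
        (tilingRep n ((tilingSystem n).simple i * w) faceNormal.1) := by
      rw [← tilingRep_simple, ← Module.End.mul_apply, ← map_mul, ← hw']
    rw [he]
    generalize tilingRep n ((tilingSystem n).simple i * w) faceNormal.1 = v at IH hsign
    fin_cases i
    · simp only [Fin.zero_eta]
      rcases IH with rfl | ⟨k, rfl⟩ | h
      · left
        rw [reflect_mirror_zero]
        ext i; fin_cases i <;> simp [faceNormal]
      · exact Or.inr (Or.inl ⟨_, reflect_mirror_zero_sideNormal n k⟩)
      · right; right
        rw [reflect_mirror_zero]
        simpa using h
    · simp only [Fin.mk_one]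
      rcases IH with rfl | ⟨k, rfl⟩ | h
      · left
        rw [reflect_mirror_one]
        ext i; fin_cases i <;> simp [faceNormal]
      · exact Or.inr (Or.inl ⟨_, reflect_mirror_one_sideNormal n k⟩)
      · right; right
        rw [reflect_mirror_one]
        simpa using h
    · simp only [Fin.reduceFinMk] at hsign ⊢
      rcases IH with rfl | ⟨k, rfl⟩ | h
      · exact Or.inr (Or.inl ⟨0, reflect_mirror_two_faceNormal n⟩)
      · by_cases h0 : (n : ℤ) ∣ k
        · obtain ⟨q, rfl⟩ := h0
          left
          rw [← zero_add ((n : ℤ) * q), sideNormal_add_mul, reflect_mirror_two_sideNormal_zero]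
        by_cases h1 : (n : ℤ) ∣ k - 1
        · obtain ⟨q, hq⟩ := h1
          obtain rfl : k = 1 + n * q := by linarith
          right; left
          refine ⟨1, ?_⟩
          rw [sideNormal_add_mul]
          exact reflect_mirror_two_sideNormal_of_cos n (by simp)
        by_cases h2 : (n : ℤ) ∣ k + 1
        · obtain ⟨q, hq⟩ := h2
          obtain rfl : k = -1 + n * q := by linarith
          right; left
          refine ⟨-1, ?_⟩
          rw [sideNormal_add_mul]
          exact reflect_mirror_two_sideNormal_of_cos n (by simp)
        right; right
        rw [reflect_mirror_two_sideNormal_three]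
        -- The worst case is `k = 2`, where the coordinate equals `1 - 4 * cos (theta n) ^ 2 ≤ -2`.
        have hc := cos_even_mul_theta_le n k h0 h1 h2
        have hB := normB_sq_mul n
        have h4 := Real.sin_sq_add_cos_sq (theta n)
        have hc4 : normB n ^ 2 * (1 - Real.cos (4 * theta n)) =
            4 * Real.cos (theta n) ^ 2 := by
          rw [show 4 * theta n = 2 * (2 * theta n) by ring, Real.cos_two_mul, Real.cos_two_mul]
          linear_combination 4 * Real.cos (theta n) ^ 2 * hB -
            8 * normB n ^ 2 * Real.cos (theta n) ^ 2 * h4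
        nlinarith [cos_theta_sq n, sq_nonneg (normB n)]
      · right; right
        -- The reflection adds to the last coordinate exactly the quantity that `hsign` makes
        -- nonpositive.
        rw [lor_mirror_two] at hsign
        have hs : (0 : ℝ) < (√2)⁻¹ := by positivity
        have := nonpos_of_mul_nonpos_right hsign hs
        rw [reflect_mirror_two]
        simp
        linarith

/-- The outward normals of the faces of the cell. -/
def faceNormals : Set Normal := Set.range fun w => (tilingIsom n w).nrm faceNormal

theorem faceNormals_cases {u : Normal} (hu : u ∈ faceNormals n) :
    u = faceNormal ∨ (∃ k, u = sideNormal n k) ∨ u.1 3 ≤ -1 := by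
  obtain ⟨w, rfl⟩ := hu
  rcases orbit_cases n w with h | ⟨k, h⟩ | h
  · exact Or.inl (Subtype.ext h)
  · exact Or.inr (Or.inl ⟨k, Subtype.ext h⟩)
  · exact Or.inr (Or.inr h)

theorem nrm_mem_faceNormals (w : TilingGroup n) {u : Normal} (hu : u ∈ faceNormals n) :
    (tilingIsom n w).nrm u ∈ faceNormals n := by
  obtain ⟨w', rfl⟩ := hu
  exact ⟨w * w', tilingIsom_nrm_mul n w w' _⟩

theorem faceNormal_mem : faceNormal ∈ faceNormals n :=
  ⟨1, by ext1; simp [tilingIsom_nrm_val]⟩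

/-- The third mirror gives side `0`; the first two act on indices by `k ↦ -k` and `k ↦ 1 - k`, whose
composite shifts `k` by one. -/
theorem sideNormal_mem (k : ℤ) : sideNormal n k ∈ faceNormals n := by
  have hsimple : ∀ (i : Fin 3) (u v : Normal), u ∈ faceNormals n →
      reflect (mirror n i) u.1 = v.1 → v ∈ faceNormals n := by
    intro i u v hu h
    have := nrm_mem_faceNormals n ((tilingSystem n).simple i) hu
    have e : (tilingIsom n ((tilingSystem n).simple i)).nrm u = v := by
      ext1
      rw [tilingIsom_nrm_val, tilingRep_simple, h]
    rwa [e] at this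
  have hnat : ∀ k : ℕ, sideNormal n k ∈ faceNormals n := by
    intro k
    induction k with
    | zero => exact hsimple 2 _ _ (faceNormal_mem n) (reflect_mirror_two_faceNormal n)
    | succ k ih =>
      have := hsimple 1 _ _ (hsimple 0 _ _ ih (reflect_mirror_zero_sideNormal n k))
        (reflect_mirror_one_sideNormal n _)
      rwa [sub_neg_eq_add, add_comm] at this
  obtain ⟨k, rfl | rfl⟩ := k.eq_nat_or_neg
  · exact hnat k
  · exact hsimple 0 _ _ (hnat k) (reflect_mirror_zero_sideNormal n k)

/-- All three mirror normals are orthogonal to `(-1, 0, 0, normA n)`. As a consequence the time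
component of a face normal is determined by its last coordinate. -/
theorem tilingRep_zero (w : TilingGroup n) (x : Fin 4 → ℝ) :
    tilingRep n w x 0 + normA n * tilingRep n w x 3 = x 0 + normA n * x 3 := by
  induction w using (tilingSystem n).simple_induction_left with
  | one => simp
  | mul_simple_left w i ih =>
    rw [map_mul, tilingRep_simple, Module.End.mul_apply, ← ih]
    fin_cases i
    · simp only [Fin.zero_eta]
      rw [reflect_mirror_zero]; simp
    · simp only [Fin.mk_one]
      rw [reflect_mirror_one]; simp
    · simp only [Fin.reduceFinMk]
      rw [reflect_mirror_two]; simp; ring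

theorem faceNormals_zero {u : Normal} (hu : u ∈ faceNormals n) :
    u.1 0 = normA n * (1 - u.1 3) := by
  obtain ⟨w, rfl⟩ := hu
  have := tilingRep_zero n w faceNormal.1
  simp only [tilingIsom_nrm_val]
  simp [faceNormal] at this ⊢
  linarith

/-- A point in the interior of the cell. -/
def basePoint : H3 := ⟨![√2, 0, 0, -1], by
  have h2 : √2 ^ 2 = (2 : ℝ) := Real.sq_sqrt (by norm_num)
  refine ⟨?_, by simp⟩
  simp only [lor, Matrix.cons_val]
  linarith⟩

theorem rightAngled : RightAngled (faceNormals n) basePoint where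
  pair := by
    rintro _ ⟨w, rfl⟩ _ ⟨w', rfl⟩
    simp only [tilingIsom_nrm_val, lor_tilingRep_left, ← Module.End.mul_apply, ← map_mul]
    rcases orbit_cases n (w⁻¹ * w') with h | ⟨k, h⟩ | h
    · left
      have : tilingRep n w (tilingRep n (w⁻¹ * w') faceNormal.1) = tilingRep n w' faceNormal.1 := by
        rw [← Module.End.mul_apply, ← map_mul, mul_inv_cancel_left]
      ext1
      rw [tilingIsom_nrm_val, tilingIsom_nrm_val, ← this, h]
    · right; left
      rw [h, lor_comm, lor_faceNormal]
      simp [sideNormal]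
    · right; right
      rwa [lor_comm, lor_faceNormal]
  nonneg u hu := by
    rw [faceNormals_zero n hu]
    apply mul_nonneg (normA_pos n).le
    rcases faceNormals_cases n hu with rfl | ⟨k, rfl⟩ | h
    · simp [faceNormal]
    · simp [sideNormal]
    · linarith
  base u hu := by
    have h0 := faceNormals_zero n hu
    have hA := one_le_normA n
    have h2 : (1 : ℝ) ≤ √2 := Real.one_le_sqrt.2 (by norm_num)
    have h1 : u.1 3 = 1 ∨ u.1 3 ≤ 0 := by
      rcases faceNormals_cases n hu with rfl | ⟨k, rfl⟩ | h
      · left; simp [faceNormal]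
      · right; simp [sideNormal]
      · right; linarith
    have e : lor basePoint.1 u.1 = -(√2 * (normA n * (1 - u.1 3))) - u.1 3 := by
      rw [← h0]; simp [lor, basePoint]; ring
    rw [e]
    rcases h1 with h | h
    · rw [h]; norm_num
    · nlinarith [mul_le_mul h2 hA (by norm_num) (by positivity)]

/-! ### The faces of the cell -/

/-- A normal with last coordinate at most `-1` projects to a causal vector of the base plane,
future-pointing or zero, so its product with every point of that plane is nonpositive. Only the side
normals cut the base face. -/
theorem cell_inter_plane : cell (faceNormals n) ∩ plane faceNormal = polygon n := by
  ext x
  constructor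
  · rintro ⟨hx, hxp⟩
    exact ⟨hxp, fun k => mem_cell.1 hx _ (sideNormal_mem n k)⟩
  · rintro ⟨hxp, hx⟩
    refine ⟨mem_cell.2 fun u hu => ?_, hxp⟩
    rcases faceNormals_cases n hu with rfl | ⟨k, rfl⟩ | h
    · exact le_of_eq hxp
    · exact hx k
    · have hx3 : x.1 3 = 0 := (lor_faceNormal x.1).symm.trans hxp
      have hu0 := (rightAngled n).nonneg u hu
      have hxs := x.sq_zero
      have hus := Normal.sq_zero u
      have hx0 := x.2.2
      by_contra! hlt
      simp only [lor, hx3, zero_mul, add_zero] at hlt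
      have hc := cauchy_schwarz₃ (x.1 1) (x.1 2) 0 (u.1 1) (u.1 2) 0
      have hsq : (x.1 0 * u.1 0) ^ 2 <
          (x.1 1 * u.1 1 + x.1 2 * u.1 2 + 0 * 0) ^ 2 :=
        pow_lt_pow_left₀ (by linarith) (mul_nonneg hx0.le hu0) two_ne_zero
      have h3 : 1 ≤ u.1 3 ^ 2 := by nlinarith
      have h4 : u.1 1 ^ 2 + u.1 2 ^ 2 + 0 ^ 2 ≤ u.1 0 ^ 2 := by linarith
      have h5 : x.1 1 ^ 2 + x.1 2 ^ 2 + 0 ^ 2 ≤ x.1 0 ^ 2 := by rw [hx3] at hxs; linarith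
      have h6 := mul_le_mul h5 h4 (by positivity) (by positivity)
      rw [mul_pow] at hsq
      linarith

theorem pt_mem_cell {w : TilingGroup n} {x : H3} (hx : x ∈ cell (faceNormals n)) :
    (tilingIsom n w).pt x ∈ cell (faceNormals n) := by
  refine mem_cell.2 fun u hu => ?_
  have := mem_cell.1 hx _ (nrm_mem_faceNormals n w⁻¹ hu)
  rwa [← (tilingIsom n w).lor_pt_nrm, tilingIsom_nrm_of_inv] at this

theorem image_cell (w : TilingGroup n) :
    (tilingIsom n w).pt '' cell (faceNormals n) = cell (faceNormals n) := by
  apply Set.Subset.antisymm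
  · rintro _ ⟨x, hx, rfl⟩
    exact pt_mem_cell n hx
  · intro x hx
    refine ⟨(tilingIsom n w⁻¹).pt x, pt_mem_cell n hx, ?_⟩
    exact Subtype.ext (tilingRep_apply_inv n w x.1)

theorem image_plane (g : Isom) (u : Normal) : g.pt '' plane u = plane (g.nrm u) := by
  ext x
  rw [g.mem_image_pt, ← g.pt_mem_plane, g.pt_symm_pt]

theorem image_cell_inter_plane (w : TilingGroup n) (u : Normal) :
    (tilingIsom n w).pt '' (cell (faceNormals n) ∩ plane u) =
      cell (faceNormals n) ∩ plane ((tilingIsom n w).nrm u) := by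
  rw [Set.image_inter (tilingIsom n w).pt_injective, image_cell, image_plane]

theorem isRegularRightAngledPolygon_face {u : Normal} (hu : u ∈ faceNormals n) :
    IsRegularRightAngledPolygon n (cell (faceNormals n) ∩ plane u) := by
  obtain ⟨w, rfl⟩ := hu
  simp only
  rw [← image_cell_inter_plane, cell_inter_plane]
  exact (tilingIsom n w).isRegularRightAngledPolygon_image (isRegularRightAngledPolygon_polygon n)

theorem span_polygon : Submodule.span ℝ ((fun x : H3 => x.1) '' polygon n) =
    lorForm.orthogonal (Submodule.span ℝ {faceNormal.1}) := by
  apply le_antisymm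
  · rw [Submodule.span_le]
    rintro _ ⟨x, hx, rfl⟩
    rw [SetLike.mem_coe, mem_orthogonal_span]
    rintro _ rfl
    exact hx.1
  · intro y hy
    rw [mem_orthogonal_span] at hy
    have hy3 : y 3 = 0 := (lor_faceNormal y).symm.trans (hy _ rfl)
    let o : H3 := ⟨![1, 0, 0, 0], by simp [lor]⟩
    have ho : ∀ u : Normal, lor o.1 u.1 = -u.1 0 := fun u => by simp [lor, o]
    have hoc : o ∈ cell (faceNormals n) ∩ plane faceNormal := by
      refine ⟨mem_cell.2 fun u hu => ?_, ?_⟩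
      · rw [ho]
        linarith [(rightAngled n).nonneg u hu]
      · change lor _ _ = 0
        rw [ho]
        simp [faceNormal]
    have hsub : cell (faceNormals n) ⊆ halfSpace faceNormal :=
      fun x hx => mem_cell.1 hx _ (faceNormal_mem n)
    have ht := (rightAngled n).mem_span_of_tangent hsub hoc (t := y - y 0 • o.1)
      (by simp [lor, o]) (by
        -- A plane of the family through the centre `o` has `u.1 0 = 0`, hence `u.1 3 = 1` by the
        -- invariant form, so it is the base plane. All directions in the base plane are therefore
        -- tangent to the face at `o`.
        intro u hu hou
        have hu0 : u.1 0 = 0 := by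
          have : lor o.1 u.1 = 0 := hou
          rw [ho] at this
          linarith
        have h3 := faceNormals_zero n hu
        rw [hu0] at h3
        have h3 := (mul_eq_zero.1 h3.symm).resolve_left (normA_pos n).ne'
        rcases faceNormals_cases n hu with rfl | ⟨k, rfl⟩ | h
        · rw [lor_faceNormal]
          simp [o, hy3]
        · simp [sideNormal] at h3
        · linarith)
    rw [cell_inter_plane] at ht hoc
    have ho' : o.1 ∈ Submodule.span ℝ ((fun x : H3 => x.1) '' polygon n) :=
      Submodule.subset_span ⟨o, hoc, rfl⟩
    have := add_mem ht (Submodule.smul_mem _ (y 0) ho')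
    rwa [sub_add_cancel] at this

theorem isFaceWithNormal_polygon :
    IsFaceWithNormal 2 (cell (faceNormals n)) (polygon n) faceNormal := by
  refine ⟨fun x hx => mem_cell.1 hx _ (faceNormal_mem n), (cell_inter_plane n).symm, ?_⟩
  rw [span_polygon, finrank_orthogonal, finrank_span_singleton]
  intro h
  have := faceNormal.2
  simp [h] at this

theorem isFace_two {u : Normal} (hu : u ∈ faceNormals n) :
    IsFace 2 (cell (faceNormals n)) (cell (faceNormals n) ∩ plane u) := by
  obtain ⟨w, rfl⟩ := hu
  simp only
  rw [← image_cell_inter_plane, cell_inter_plane]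
  have := (tilingIsom n w).isFaceWithNormal_image (isFaceWithNormal_polygon n)
  rw [image_cell] at this
  exact ⟨_, this⟩

theorem isFace_one_inter {u v : Normal} (hu : u ∈ faceNormals n) (hv : v ∈ faceNormals n)
    (huv : lor u.1 v.1 = 0) :
    IsFace 1 (cell (faceNormals n) ∩ plane u) (cell (faceNormals n) ∩ plane u ∩ plane v) := by
  obtain ⟨w, rfl⟩ := hu
  obtain ⟨v, rfl⟩ : ∃ v', v = (tilingIsom n w).nrm v' := ⟨_, (tilingIsom_nrm_of_inv n w v).symm⟩
  have hv' : v ∈ faceNormals n := by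
    have := nrm_mem_faceNormals n w⁻¹ hv
    rwa [tilingIsom_nrm_inv] at this
  simp only at huv ⊢
  rw [tilingIsom_nrm_val, tilingIsom_nrm_val, lor_tilingRep, lor_comm, lor_faceNormal] at huv
  -- After moving `u` to `faceNormal`, orthogonality says that the last coordinate of `v` is `0`,
  -- which leaves only side normals.
  obtain ⟨k, rfl⟩ : ∃ k, v = sideNormal n k := by
    rcases faceNormals_cases n hv' with rfl | h | h
    · simp [faceNormal] at huv
    · exact h
    · linarith
  rw [← image_cell_inter_plane, ← image_plane, cell_inter_plane,
    ← Set.image_inter (tilingIsom n w).pt_injective]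
  apply Isom.isFace_image
  have := isFace_segment n (k - 1)
  rwa [← polygon_inter_plane, sub_add_cancel] at this

end Tiling

/-! ### The volume of the cell -/

open MeasureTheory

theorem measurable_lift : Measurable lift := by
  refine Measurable.subtype_mk ?_
  rw [measurable_pi_iff]
  intro i
  fin_cases i <;> simp <;> fun_prop

section Volume

variable (n : ℕ) [hn : Fact (6 ≤ n)]

/-- The cell contains a horoball, up to the side of a plane. -/
theorem mem_cell_of_horoball {y : H3} (h3 : y.1 3 ≤ 0) (h : y.1 0 + y.1 3 ≤ 1) :
    y ∈ cell (faceNormals n) := by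
  refine mem_cell.2 fun u hu => ?_
  have hA := one_le_normA n
  obtain ⟨κ, hκ, hκ0, hκ1⟩ : ∃ κ, 1 / normA n = 1 - κ ∧ 0 ≤ κ ∧ κ ≤ 1 := by
    refine ⟨1 - 1 / normA n, by ring, ?_, ?_⟩
    · rw [sub_nonneg, div_le_one (normA_pos n)]
      exact hA
    · have : 0 < 1 / normA n := div_pos one_pos (normA_pos n)
      linarith
  have hu3 : u.1 3 = 1 - (1 - κ) * u.1 0 := by
    have := normA_pos n
    rw [← hκ, faceNormals_zero n hu]
    field_simp
    ring
  have ha := (rightAngled n).nonneg u hu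
  have hus := Normal.sq_zero u
  have hys := y.sq_zero
  have hy0 := y.2.2
  have hc := cauchy_schwarz₃ (y.1 1) (y.1 2) 0 (u.1 1) (u.1 2) 0
  -- In these coordinates `δ = y.1 0 + y.1 3` is the horospherical height, with `0 < δ ≤ 1`, and `s
  -- ≥ 0` is the depth behind the base plane.
  obtain ⟨s, hs⟩ : ∃ s, y.1 3 = -s := ⟨-y.1 3, by ring⟩
  obtain ⟨δ, hδ⟩ : ∃ δ, y.1 0 = s + δ := ⟨y.1 0 - s, by ring⟩
  have hs0 : 0 ≤ s := by linarith
  have hδ1 : δ ≤ 1 := by linarith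
  have hδ0 : 0 < δ := by
    by_contra! hle
    rw [hs, hδ] at hys
    rw [hδ] at hy0
    nlinarith [sq_nonneg (y.1 1), sq_nonneg (y.1 2)]
  set a := u.1 0
  have hr : y.1 1 ^ 2 + y.1 2 ^ 2 + 0 ^ 2 ≤ 2 * s * δ := by
    rw [hs, hδ] at hys
    nlinarith
  have hρ : u.1 1 ^ 2 + u.1 2 ^ 2 + 0 ^ 2 = a ^ 2 * (κ * (2 - κ)) + 2 * a * (1 - κ) := by
    rw [hu3] at hus
    linarith
  have hρ0 : 0 ≤ u.1 1 ^ 2 + u.1 2 ^ 2 + 0 ^ 2 := by positivity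
  have hmul := mul_le_mul_of_nonneg_right hr hρ0
  have hR : 0 ≤ s + a * (δ + s * κ) := by positivity
  have hsq : (y.1 1 * u.1 1 + y.1 2 * u.1 2 + 0 * 0) ^ 2 ≤ (s + a * (δ + s * κ)) ^ 2 := by
    refine (hc.trans hmul).trans ?_
    rw [hρ]
    -- After Cauchy–Schwarz the defect is a sum of nonnegative terms. For `κ = 0`, the case `n = 6`,
    -- only the square `(s - a * δ) ^ 2` remains.
    have e : (s + a * (δ + s * κ)) ^ 2 -
        2 * s * δ * (a ^ 2 * (κ * (2 - κ)) + 2 * a * (1 - κ)) =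
        (s - a * (δ - s * κ)) ^ 2 + 4 * (s * δ * a * κ) + 2 * (s * δ * κ ^ 2 * a ^ 2) := by ring
    have : 0 ≤ (s - a * (δ - s * κ)) ^ 2 + 4 * (s * δ * a * κ) + 2 * (s * δ * κ ^ 2 * a ^ 2) := by
      positivity
    linarith
  have hle := abs_le_of_sq_le_sq' hsq hR
  have := hle.2
  simp only [lor]
  rw [hs, hδ, hu3]
  linarith

/-- The horosphere `y 0 + y 3 = 1` of the ambient coordinates is a paraboloid over the horizontal
plane, so depth `m ^ 2` leaves room for an `m` by `m` square. -/
theorem box_subset {m : ℝ} (hm : 1 ≤ m) :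
    Set.Icc ![0, 0, -(2 * m ^ 2)] ![m, m, -m ^ 2] ⊆ lift ⁻¹' cell (faceNormals n) := by
  intro y hy
  have hy0 := hy.1 0
  have hy1 := hy.1 1
  have hy2 := hy.1 2
  have hz0 := hy.2 0
  have hz1 := hy.2 1
  have hz2 := hy.2 2
  simp at hy0 hy1 hy2 hz0 hz1 hz2
  apply mem_cell_of_horoball
  · simp only [lift, Matrix.cons_val]
    nlinarith
  · simp only [lift, Matrix.cons_val]
    have : √(1 + y 0 ^ 2 + y 1 ^ 2 + y 2 ^ 2) ≤ 1 - y 2 := by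
      apply Real.sqrt_le_iff.2
      constructor <;> nlinarith
    linarith

theorem density_le {m : ℝ} (hm : 1 ≤ m) {y : Fin 3 → ℝ}
    (hy : y ∈ Set.Icc ![0, 0, -(2 * m ^ 2)] ![m, m, -m ^ 2]) :
    1 / (3 * m ^ 2) ≤ 1 / √(1 + y 0 ^ 2 + y 1 ^ 2 + y 2 ^ 2) := by
  have hy0 := hy.1 0
  have hy1 := hy.1 1
  have hy2 := hy.1 2
  have hz0 := hy.2 0
  have hz1 := hy.2 1
  have hz2 := hy.2 2
  simp at hy0 hy1 hy2 hz0 hz1 hz2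
  apply one_div_le_one_div_of_le (Real.sqrt_pos.2 (by positivity))
  have hm2 : 1 ≤ m ^ 2 := one_le_pow₀ hm
  have h0 : y 0 ^ 2 ≤ m ^ 2 := pow_le_pow_left₀ hy0 hz0 2
  have h1 : y 1 ^ 2 ≤ m ^ 2 := pow_le_pow_left₀ hy1 hz1 2
  have h2 : y 2 ^ 2 ≤ (2 * m ^ 2) ^ 2 := by
    rw [← neg_sq]
    exact pow_le_pow_left₀ (by linarith) (by linarith) 2
  apply Real.sqrt_le_iff.2
  constructor
  · positivity
  · nlinarith

/-- The box has Lebesgue volume `m ^ 4`, while the density decays only like `m ^ (-2)`. -/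
theorem le_hypVolume_cell {m : ℝ} (hm : 1 ≤ m) :
    ENNReal.ofReal (m ^ 2 / 3) ≤ hypVolume (cell (faceNormals n)) := by
  set K : Set (Fin 3 → ℝ) := Set.Icc ![0, 0, -(2 * m ^ 2)] ![m, m, -m ^ 2]
  have hm0 : 0 < m := by linarith
  have hK : volume K = ENNReal.ofReal (m ^ 4) := by
    rw [Real.volume_Icc_pi, Fin.prod_univ_three]
    simp only [Matrix.cons_val]
    rw [← ENNReal.ofReal_mul (by linarith), ← ENNReal.ofReal_mul (by nlinarith)]
    congr 1
    ring
  calc ENNReal.ofReal (m ^ 2 / 3)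
      = ENNReal.ofReal (1 / (3 * m ^ 2)) * volume K := by
        rw [hK, ← ENNReal.ofReal_mul (by positivity)]
        congr 1
        field_simp
    _ = ∫⁻ _ in K, ENNReal.ofReal (1 / (3 * m ^ 2)) := (setLIntegral_const _ _).symm
    _ ≤ ∫⁻ y in K, ENNReal.ofReal (1 / √(1 + y 0 ^ 2 + y 1 ^ 2 + y 2 ^ 2)) :=
        setLIntegral_mono' measurableSet_Icc fun y hy =>
          ENNReal.ofReal_le_ofReal (density_le hm hy)
    _ ≤ (volume.withDensity
          fun y => ENNReal.ofReal (1 / √(1 + y 0 ^ 2 + y 1 ^ 2 + y 2 ^ 2))) K :=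
        withDensity_apply_le _ _
    _ ≤ (volume.withDensity
          fun y => ENNReal.ofReal (1 / √(1 + y 0 ^ 2 + y 1 ^ 2 + y 2 ^ 2)))
            (lift ⁻¹' cell (faceNormals n)) := measure_mono (box_subset n hm)
    _ ≤ hypVolume (cell (faceNormals n)) :=
        Measure.le_map_apply measurable_lift.aemeasurable _

theorem hypVolume_cell : hypVolume (cell (faceNormals n)) = ⊤ := by
  refine ENNReal.eq_top_of_forall_nnreal_le fun r => ?_
  have hr := r.2
  refine le_trans ?_ (le_hypVolume_cell n (m := 1 + 3 * r) (by simp))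
  rw [← ENNReal.ofReal_coe_nnreal]
  apply ENNReal.ofReal_le_ofReal
  nlinarith [sq_nonneg (r : ℝ), r.coe_nonneg]

end Volume

end Hyp3

end

theorem mainTheorem9 (n : ℕ) (hn : 6 ≤ n) :
    ∃ C : Set Hyp3.H3,
      Hyp3.IsConvexPolyhedron C ∧
      Hyp3.hypVolume C = ⊤ ∧
      (∃ F, Hyp3.IsFace 2 C F) ∧
      (∀ F, Hyp3.IsFace 2 C F → Hyp3.IsRegularRightAngledPolygon n F) ∧
      (∀ F G u v, Hyp3.IsFaceWithNormal 2 C F u → Hyp3.IsFaceWithNormal 2 C G v →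
        F ≠ G → (F ∩ G).Nonempty →
          Hyp3.IsFace 1 F (F ∩ G) ∧ Hyp3.IsFace 1 G (F ∩ G) ∧
          Hyp3.dihedralAngle u v = Real.pi / 2) ∧
      (∀ p : Hyp3.H3, Hyp3.IsFace 0 C {p} →
        {F | Hyp3.IsFace 2 C F ∧ p ∈ F}.ncard = 3 ∧
        {E | Hyp3.IsFace 1 C E ∧ p ∈ E}.ncard = 3) := by
  have : Fact (6 ≤ n) := ⟨hn⟩
  have hO := Hyp3.rightAngled n
  refine ⟨Hyp3.cell (Hyp3.faceNormals n), hO.isConvexPolyhedron, Hyp3.hypVolume_cell n,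
    ⟨_, Hyp3.isFace_two n (Hyp3.faceNormal_mem n)⟩, ?_, ?_, ?_⟩
  · rintro F ⟨u, hu⟩
    rw [hu.2.1]
    exact Hyp3.isRegularRightAngledPolygon_face n (hO.normal_mem hu)
  · rintro F G u v hF hG hne ⟨x, hxF, hxG⟩
    have hu := hO.normal_mem hF
    have hv := hO.normal_mem hG
    have eF := hF.2.1
    have eG := hG.2.1
    subst eF eG
    have huv : u ≠ v := by
      rintro rfl
      exact hne rfl
    have horth := hO.orthogonal_of_mem hu hv huv hxF.2 hxG.2
    have e : Hyp3.cell (Hyp3.faceNormals n) ∩ Hyp3.plane u ∩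
        (Hyp3.cell (Hyp3.faceNormals n) ∩ Hyp3.plane v) =
        Hyp3.cell (Hyp3.faceNormals n) ∩ Hyp3.plane u ∩ Hyp3.plane v := by
      rw [← Set.inter_inter_distrib_left, Set.inter_assoc]
    refine ⟨?_, ?_, ?_⟩
    · rw [e]
      exact Hyp3.isFace_one_inter n hu hv horth
    · rw [e, Set.inter_right_comm]
      exact Hyp3.isFace_one_inter n hv hu ((Hyp3.lor_comm _ _).trans horth)
    · rw [Hyp3.dihedralAngle, horth, Real.arccos_zero]
      ring
  · intro p hp
    exact hO.ncard_faces_and_edges (fun u hu => Hyp3.isFace_two n hu)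
      (fun u hu v hv h => Hyp3.isFace_one_inter n hu hv h) hp
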